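/- Let $G$ be a finite group. Define $\gamma_j^*$-commutators of $G$ for integers $j\ge 1$ as follows: every element of $G$ is a $\gamma_1^*$-commutator; for $j\ge 2$, an element $g\in G$ is a $\gamma_j^*$-commutator if $g=[a,b]$ for some $a,b\in G$ of coprime orders such that $a$ is a power of a $\gamma_{j-1}^*$-commutator. Here $[a,b]=aba^{-1}b^{-1}$ (the convention $a^{-1}b^{-1}ab$ gives the same sets). Let $\gamma_j^*(G)$ be the subgroup generated by all $\gamma_j^*$-commutators of $G$. **Theorem 1.1.** (i) There is a function $f:\mathbb N\to\mathbb N$ such that the following holds for all integers $m\ge 0$, $j\ge 1$ and every finite group $G$. If there are $m$ cyclic subgroups of $G$ whose union contains all $\gamma_j^*$-commutators of $G$, then there is a subgroup $\Delta\le\gamma_j^*(G)$, normal in $G$, such that $|\Delta|\le f(m)$ and $\gamma_j^*(G)/\Delta$ is cyclic. (ii) For every integer $j\ge 2$ and every finite group $G$, $\gamma_j^*(G)=\gamma_\infty(G)$, where $\gamma_\infty(G)$ is the last term of the lower central series of $G$, that is, the intersection of all its terms. -/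

import Mathlib

open scoped commutatorElement

universe u

/-- The set of `γ_j^*`-commutators of `G`. Every element is a `γ_1^*`-commutator; for `j ≥ 2`, an
element is a `γ_j^*`-commutator if it equals `[a, b]` where `a` is a power of some
`γ_{j-1}^*`-commutator, `b` is any element of `G`, and the orders of `a` and `b` are coprime.
The index `j = 0` is not used (the value there is a filler).

The convention for `[a, b]` is immaterial: since `a` and `b` may be replaced by their inverses,
`a b a⁻¹ b⁻¹` and `a⁻¹ b⁻¹ a b` give the same set. -/
def gammaStarCommutators (G : Type*) [Group G] : ℕ → Set G
  | 0 => Set.univ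
  | 1 => Set.univ
  | j + 2 => {g | ∃ y ∈ gammaStarCommutators G (j + 1), ∃ a ∈ Subgroup.zpowers y, ∃ b : G,
      (orderOf a).Coprime (orderOf b) ∧ g = ⁅a, b⁆}

/-- The subgroup `γ_j^*(G)` generated by all `γ_j^*`-commutators of `G`. -/
def gammaStar (G : Type*) [Group G] (j : ℕ) : Subgroup G :=
  Subgroup.closure (gammaStarCommutators G j)

/-- The intersection `γ_∞(G)` of the terms of the lower central series of `G`. For finite `G` the
series is decreasing and stabilizes, so this is its last term. -/
def gammaInfty (G : Type*) [Group G] : Subgroup G :=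
  ⨅ n : ℕ, (⊤ : Subgroup G).lowerCentralSeries n

open scoped Nat

/-! (ii) In a finite nilpotent group elements of coprime orders commute, so for `j ≥ 2` all
`γ_j^*`-commutators lie in every term of the lower central series. Conversely, `γ_j^*`-commutators
lift along surjections, so modulo `γ_{j+1}^*(G)` each power of a `γ_j^*`-commutator commutes with
every element of coprime order. By `Group.isNilpotent_of_forall_commute`, nilpotency then passes
from `G/γ_j^*(G)` to `G/γ_{j+1}^*(G)`.

(i) Let `N = γ_j^*(G)`. Take for `Δ` the kernel of `x ↦ x^{m!}` from `N` to its abelianization. It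
is characteristic in `N`, and `N/Δ` is the image of that map.

The image is cyclic. One may assume `N` abelian; let `W` be the `p`-torsion of `N^{m!}`. For `j = 1`
a pigeonhole on the `m` cyclic subgroups gives `|W| ≤ p`. For `j ≥ 2`, `G` acts on `N` through a
nilpotent group; let `K` be its Hall `p'`-subgroup. For a `p'`-element `h`, the elements `[v,h]`,
with `v` in the `p`-part of `N`, form a group of `γ_j^*`-commutators, so the pigeonhole gives
`|[W,h]| ≤ p`. By `map_displacement_eq` all nontrivial `[W,h]` are the same line, and since the norm
of `K` vanishes on `W`, that line contains `W`.

`Δ` is bounded. Let `K` now be the subgroup of `N` normalizing every cyclic subgroup generated by a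
`γ_j^*`-commutator. It contains all `m!`-th powers, has bounded index, and `[K,K]` is central.
Modulo `[K,K]` the derived subgroup of `N` is bounded, hence so is `|Δ : [K,K]|`. Finally `K` has
class at most 2 and `K/(K ∩ Δ)` is cyclic, so `K` has boundedly many commutators, and a quantitative
form of Schur's theorem bounds `[K,K]`. -/

/-! ### Coprime lifting and functoriality of `γ_j^*`. -/

/-- If a prime `q` divides the order of `g` but not that of `f g`, then raising to the power `q` is
invertible on `⟨f g⟩`, so a suitable power of `g ^ q` has the same image and smaller order. This
lets coprimality of orders be lifted along a surjection. -/
theorem exists_mem_zpowers_map_eq_and_prime_dvd {G H : Type*} [Group G] [Group H] [Finite G]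
    (f : G →* H) (g : G) : ∃ a ∈ Subgroup.zpowers g, f a = f g ∧
      ∀ q : ℕ, q.Prime → q ∣ orderOf a → q ∣ orderOf (f g) := by
  induction hn : orderOf g using Nat.strong_induction_on generalizing g with
  | _ n ih =>
    by_cases h : ∀ q : ℕ, q.Prime → q ∣ orderOf g → q ∣ orderOf (f g)
    · exact ⟨g, Subgroup.mem_zpowers g, rfl, h⟩
    push Not at h
    obtain ⟨q, hq, hqg, hqf⟩ := h
    obtain ⟨s, hs⟩ := exists_pow_eq_self_of_coprime
      ((Nat.Prime.coprime_iff_not_dvd hq).2 hqf)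
    have hlt : orderOf ((g ^ q) ^ s) < n := by
      have h1 := Nat.le_of_dvd (orderOf_pos _) (orderOf_pow_dvd (x := g ^ q) s)
      rw [orderOf_pow_of_dvd hq.ne_zero hqg, hn] at h1
      exact h1.trans_lt (Nat.div_lt_self (hn ▸ orderOf_pos g) hq.one_lt)
    have hf : f ((g ^ q) ^ s) = f g := by simpa using hs
    obtain ⟨a, ha, hfa, hp⟩ := ih _ hlt ((g ^ q) ^ s) rfl
    refine ⟨a, ?_, hfa.trans hf, by rwa [hf] at hp⟩
    exact (Subgroup.zpowers_le.2 (Subgroup.pow_mem _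
      (Subgroup.pow_mem _ (Subgroup.mem_zpowers g) _) _)) ha

theorem coprime_of_prime_dvd {a b c d : ℕ} (h : c.Coprime d)
    (ha : ∀ q : ℕ, q.Prime → q ∣ a → q ∣ c) (hb : ∀ q : ℕ, q.Prime → q ∣ b → q ∣ d) :
    a.Coprime b :=
  Nat.coprime_of_dvd fun q hq hqa hqb =>
    Nat.not_coprime_of_dvd_of_dvd hq.one_lt (ha q hq hqa) (hb q hq hqb) h

theorem exists_prime_part {G : Type*} [Group G] [Finite G] (p : ℕ) [hp : Fact p.Prime] (x : G) :
    ∃ u ∈ Subgroup.zpowers x, ∃ v ∈ Subgroup.zpowers x, x = u * v ∧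
      (∃ k, orderOf u = p ^ k) ∧ (orderOf v).Coprime p := by
  obtain ⟨k, c, hc, hx⟩ := Nat.exists_eq_pow_mul_and_not_dvd (orderOf_pos x).ne' p hp.out.ne_one
  have hcop : IsCoprime ((p ^ k : ℕ) : ℤ) (c : ℤ) :=
    Nat.isCoprime_iff_coprime.2 (((Nat.Prime.coprime_iff_not_dvd hp.out).2 hc).pow_left k)
  obtain ⟨a, b, hab⟩ := hcop
  refine ⟨x ^ (b * c), ⟨_, rfl⟩, x ^ (a * (p ^ k : ℕ)), ⟨_, rfl⟩, ?_, ?_, ?_⟩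
  · rw [← zpow_add, add_comm, hab, zpow_one]
  · refine ((Nat.dvd_prime_pow hp.out).1 (orderOf_dvd_of_pow_eq_one (n := p ^ k) ?_)).imp
      fun _ h => h.2
    rw [← zpow_natCast, ← zpow_mul, mul_assoc, mul_comm (c : ℤ), ← Nat.cast_mul, ← hx, mul_comm,
      zpow_mul, zpow_natCast, pow_orderOf_eq_one, one_zpow]
  · refine Nat.Coprime.coprime_dvd_left (orderOf_dvd_of_pow_eq_one (n := c) ?_)
      ((Nat.Prime.coprime_iff_not_dvd hp.out).2 hc).symm
    rw [← zpow_natCast, ← zpow_mul, mul_assoc, ← Nat.cast_mul, ← hx, mul_comm,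
      zpow_mul, zpow_natCast, pow_orderOf_eq_one, one_zpow]

theorem gammaStarCommutators_conj {G : Type*} [Group G] (j : ℕ) {x : G}
    (hx : x ∈ gammaStarCommutators G j) (g : G) : g * x * g⁻¹ ∈ gammaStarCommutators G j := by
  rcases j with _ | j
  · trivial
  induction j generalizing x with
  | zero => trivial
  | succ j ih =>
    obtain ⟨y, hy, a, ⟨k, rfl⟩, b, hab, rfl⟩ := hx
    refine ⟨_, ih hy, g * y ^ k * g⁻¹, ⟨k, ?_⟩, g * b * g⁻¹, ?_, ?_⟩
    · simp [conj_zpow]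
    · have h (z : G) : orderOf (g * z * g⁻¹) = orderOf z := by
        rw [← MulAut.conj_apply]
        exact orderOf_injective (MulAut.conj g).toMonoidHom (MulAut.conj g).injective z
      rwa [h, h]
    · simp only [commutatorElement_def]; group

theorem gammaStarCommutators_map {G H : Type*} [Group G] [Group H] [Finite G] (f : G →* H)
    (j : ℕ) {x : G} (hx : x ∈ gammaStarCommutators G j) : f x ∈ gammaStarCommutators H j := by
  rcases j with _ | j
  · trivial
  induction j generalizing x with
  | zero => trivial
  | succ j ih =>
    obtain ⟨y, hy, a, ⟨k, rfl⟩, b, hab, rfl⟩ := hx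
    refine ⟨_, ih hy, f (y ^ k), ⟨k, by simp⟩, f b, ?_, map_commutatorElement f _ _⟩
    exact Nat.Coprime.coprime_dvd_left (orderOf_map_dvd f _)
      (Nat.Coprime.coprime_dvd_right (orderOf_map_dvd f _) hab)

theorem exists_gammaStarCommutators_map_eq {G H : Type*} [Group G] [Group H] [Finite G]
    (f : G →* H) (hf : Function.Surjective f) (j : ℕ) {x : H}
    (hx : x ∈ gammaStarCommutators H j) : ∃ g ∈ gammaStarCommutators G j, f g = x := by
  rcases j with _ | j
  · exact (hf x).imp fun g h => ⟨trivial, h⟩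
  induction j generalizing x with
  | zero => exact (hf x).imp fun g h => ⟨trivial, h⟩
  | succ j ih =>
    obtain ⟨y, hy, a, ⟨k, rfl⟩, b, hab, rfl⟩ := hx
    obtain ⟨z, hz, rfl⟩ := ih hy
    obtain ⟨c, rfl⟩ := hf b
    obtain ⟨a', ha', hfa', hpa'⟩ := exists_mem_zpowers_map_eq_and_prime_dvd f (z ^ k)
    obtain ⟨b', hb', hfb', hpb'⟩ := exists_mem_zpowers_map_eq_and_prime_dvd f c
    refine ⟨⁅a', b'⁆, ⟨z, hz, a', ?_, b', ?_, rfl⟩, ?_⟩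
    · exact Subgroup.zpowers_le.2 (Subgroup.zpow_mem _ (Subgroup.mem_zpowers z) k) ha'
    · refine coprime_of_prime_dvd hab ?_ hpb'
      simpa using hpa'
    · rw [map_commutatorElement, hfa', hfb', map_zpow]

theorem gammaStar_map {G H : Type*} [Group G] [Group H] [Finite G]
    (f : G →* H) (hf : Function.Surjective f) (j : ℕ) :
    (gammaStar G j).map f = gammaStar H j := by
  rw [gammaStar, gammaStar, MonoidHom.map_closure]
  congr 1
  ext x
  constructor
  · rintro ⟨y, hy, rfl⟩
    exact gammaStarCommutators_map f j hy
  · exact exists_gammaStarCommutators_map_eq f hf j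

instance gammaStar_normal {G : Type*} [Group G] (j : ℕ) : (gammaStar G j).Normal := by
  have : Group.conjugatesOfSet (gammaStarCommutators G j) = gammaStarCommutators G j := by
    refine Set.Subset.antisymm (fun x hx => ?_) Group.subset_conjugatesOfSet
    obtain ⟨y, hy, h⟩ := Group.mem_conjugatesOfSet_iff.1 hx
    obtain ⟨g, rfl⟩ := isConj_iff.1 h
    exact gammaStarCommutators_conj j hy g
  rw [gammaStar, ← this]
  exact Subgroup.normalClosure_normal

/-! ### Nilpotency criterion and part (ii). -/

theorem Subgroup.eq_top_of_forall_exists_sylow_le {G : Type*} [Group G] [Finite G] (H : Subgroup G)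
    (h : ∀ p : ℕ, p.Prime → ∃ P : Sylow p G, (P : Subgroup G) ≤ H) : H = ⊤ := by
  rw [← Subgroup.index_eq_one, Nat.eq_one_iff_not_exists_prime_dvd]
  intro p hp hdvd
  obtain ⟨P, hP⟩ := h p hp
  have := Fact.mk hp
  exact P.not_dvd_index (hdvd.trans (Subgroup.index_dvd_of_le hP))

theorem Group.commute_of_coprime_orderOf {G : Type*} [Group G] [Finite G] [h : Group.IsNilpotent G]
    {a b : G} (hab : (orderOf a).Coprime (orderOf b)) : Commute a b := by
  obtain ⟨e⟩ := ((Group.isNilpotent_of_finite_tfae (G := G)).out 0 4).1 h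
  have key : Commute (e.symm a) (e.symm b) := by
    refine funext fun p => funext fun P => ?_
    have hp : Fact (p : ℕ).Prime := ⟨Nat.prime_of_mem_primeFactors p.2⟩
    have h1 (z : G) : orderOf (e.symm z p P) ∣ orderOf z := by
      apply orderOf_dvd_of_pow_eq_one
      have := congrFun (congrFun (congrArg e.symm (pow_orderOf_eq_one z)) p) P
      rwa [map_pow, map_one] at this
    obtain ⟨k, hk⟩ := (IsPGroup.iff_orderOf.1 P.2) (e.symm a p P)
    obtain ⟨l, hl⟩ := (IsPGroup.iff_orderOf.1 P.2) (e.symm b p P)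
    have h2 := Nat.Coprime.coprime_dvd_left (h1 a) (Nat.Coprime.coprime_dvd_right (h1 b) hab)
    rw [hk, hl] at h2
    change e.symm a p P * e.symm b p P = e.symm b p P * e.symm a p P
    rcases k with _ | k
    · rw [pow_zero, orderOf_eq_one_iff] at hk
      rw [hk, one_mul, mul_one]
    rcases l with _ | l
    · rw [pow_zero, orderOf_eq_one_iff] at hl
      rw [hl, one_mul, mul_one]
    · exact absurd h2 (Nat.not_coprime_of_dvd_of_dvd hp.out.one_lt (dvd_pow_self _ (by simp))
        (dvd_pow_self _ (by simp)))
  have := congrArg e key.eq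
  rwa [map_mul, map_mul, e.apply_symm_apply, e.apply_symm_apply] at this

/-- A Sylow `p`-subgroup is normalized by itself and by the central `p'`-elements, so it is normal
and contains all the generators. -/
theorem IsPGroup.of_closure_eq_top {G : Type*} [Group G] [Finite G] (p : ℕ) [hp : Fact p.Prime]
    (S : Set G) (hS : Subgroup.closure S = ⊤) (hpS : ∀ s ∈ S, ∃ k, orderOf s = p ^ k)
    (hc : ∀ g : G, (orderOf g).Coprime p → ∀ x, Commute g x) : IsPGroup p G := by
  obtain ⟨Q⟩ : Nonempty (Sylow p G) := inferInstance
  have hn : Subgroup.normalizer (Q : Set G) = ⊤ := by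
    apply Subgroup.eq_top_of_forall_exists_sylow_le
    intro r hr
    have := Fact.mk hr
    rcases eq_or_ne r p with rfl | hrp
    · exact ⟨Q, Subgroup.le_normalizer⟩
    obtain ⟨R⟩ : Nonempty (Sylow r G) := inferInstance
    refine ⟨R, fun g hg => ?_⟩
    obtain ⟨k, hk⟩ := (IsPGroup.iff_orderOf.1 R.2) ⟨g, hg⟩
    rw [Subgroup.orderOf_mk] at hk
    have hcg := hc g (by rw [hk]; exact ((Nat.coprime_primes hr hp.out).2 hrp).pow_left k)
    change g ∈ Subgroup.normalizer ((Q : Subgroup G) : Set G)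
    rw [Subgroup.mem_normalizer_iff]
    intro x
    rw [(hcg x).eq, mul_inv_cancel_right]
  have hQn : (Q : Subgroup G).Normal := Subgroup.normalizer_eq_top_iff.1 hn
  have := Sylow.unique_of_normal Q hQn
  have hle : Subgroup.closure S ≤ Q := by
    rw [Subgroup.closure_le]
    intro s hs
    obtain ⟨k, hk⟩ := hpS s hs
    have hz : IsPGroup p (Subgroup.zpowers s) := IsPGroup.of_card (by rw [Nat.card_zpowers, hk])
    obtain ⟨Q', hQ'⟩ := hz.exists_le_sylow
    rw [Subsingleton.elim Q Q']
    exact hQ' (Subgroup.mem_zpowers s)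
  rw [hS, top_le_iff] at hle
  have h2 := Q.2
  intro g
  have hg : g ∈ (Q : Subgroup G) := hle ▸ Subgroup.mem_top g
  obtain ⟨k, hk⟩ := h2 ⟨g, hg⟩
  exact ⟨k, by simpa [Subtype.ext_iff] using hk⟩

/-- Every Sylow subgroup `Q` is normal: the `p`-parts of elements of `X` generate a normal
`p`-subgroup, contained in `Q`, and their `p'`-parts centralize `Q`. Hence `N` normalizes `Q`, and a
Frattini argument finishes. -/
theorem Group.isNilpotent_of_forall_commute {G : Type*} [Group G] [Finite G] (X : Set G)
    (hX : ∀ x ∈ X, ∀ g : G, g * x * g⁻¹ ∈ X)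
    (hcomm : ∀ x ∈ X, ∀ a ∈ Subgroup.zpowers x, ∀ b : G, (orderOf a).Coprime (orderOf b) →
      Commute a b)
    (N : Subgroup G) [N.Normal] (hN : N = Subgroup.closure X) (hq : Group.IsNilpotent (G ⧸ N)) :
    Group.IsNilpotent G := by
  refine ((Group.isNilpotent_of_finite_tfae (G := G)).out 0 3).2 ?_
  intro p hp Q
  have hpp := hp.out
  -- the subgroup generated by the `p`-parts of the elements of `X` is a normal `p`-group
  let S : Set G := {u | ∃ x ∈ X, u ∈ Subgroup.zpowers x ∧ ∃ k, orderOf u = p ^ k}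
  let K : Subgroup G := Subgroup.closure S
  have hSconj : Group.conjugatesOfSet S = S := by
    refine Set.Subset.antisymm (fun z hz => ?_) Group.subset_conjugatesOfSet
    obtain ⟨y, ⟨x, hx, ⟨i, rfl⟩, k, hk⟩, h⟩ := Group.mem_conjugatesOfSet_iff.1 hz
    obtain ⟨g, rfl⟩ := isConj_iff.1 h
    refine ⟨_, hX x hx g, ⟨i, by simp [conj_zpow]⟩, k, ?_⟩
    rw [← hk, ← MulAut.conj_apply]
    exact orderOf_injective (MulAut.conj g).toMonoidHom (MulAut.conj g).injective _
  have hKn : K.Normal := by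
    change (Subgroup.closure S).Normal
    rw [← hSconj]
    exact Subgroup.normalClosure_normal
  have hKc : ∀ g : G, (orderOf g).Coprime p → ∀ x ∈ K, Commute g x := by
    intro g hg x hx
    have hle : K ≤ Subgroup.centralizer {g} := by
      refine (Subgroup.closure_le _).2 ?_
      rintro u ⟨x, hx, hu, k, hk⟩
      rw [SetLike.mem_coe, Subgroup.mem_centralizer_singleton_iff]
      exact (hcomm x hx u hu g (by rw [hk]; exact (hg.symm.pow_left k))).eq
    exact ((Subgroup.mem_centralizer_singleton_iff.1 (hle hx)) : x * g = g * x).symm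
  have hKp : IsPGroup p K := by
    refine IsPGroup.of_closure_eq_top p (((↑) : K → G) ⁻¹' S)
      Subgroup.closure_closure_coe_preimage ?_ ?_
    · rintro ⟨s, hs⟩ ⟨x, hx, hu, k, hk⟩
      exact ⟨k, by rw [Subgroup.orderOf_mk]; exact hk⟩
    · rintro ⟨g, hg⟩ hgp ⟨x, hx⟩
      rw [Subgroup.orderOf_mk] at hgp
      exact Subtype.ext (hKc g hgp x hx)
  have hKQ : K ≤ Q := hKp.le_sylow_of_normal Q
  have hXQ : N ≤ Subgroup.normalizer (Q : Set G) := by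
    rw [hN, Subgroup.closure_le]
    intro x hx
    obtain ⟨u, hu, v, hv, hxuv, ⟨k, hk⟩, hvp⟩ := exists_prime_part p x
    rw [hxuv]
    refine mul_mem (Subgroup.le_normalizer (hKQ (Subgroup.subset_closure ⟨x, hx, hu, k, hk⟩))) ?_
    have hvc : v ∈ Subgroup.centralizer (Q : Set G) := by
      rw [Subgroup.mem_centralizer_iff]
      intro y hy
      obtain ⟨l, hl⟩ := (IsPGroup.iff_orderOf.1 Q.2) ⟨y, hy⟩
      rw [Subgroup.orderOf_mk] at hl
      exact (hcomm x hx v hv y (by rw [hl]; exact hvp.pow_right l)).eq.symm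
    change v ∈ Subgroup.normalizer ((Q : Subgroup G) : Set G)
    rw [Subgroup.mem_normalizer_iff]
    intro y
    have hcm := Subgroup.mem_centralizer_iff.1 hvc
    constructor
    · intro hy
      rwa [← hcm y hy, mul_inv_cancel_right]
    · intro hy
      have := hcm _ hy
      have h2 : v * y * v⁻¹ = y := by
        have h3 : v * y = v * (v * y * v⁻¹) := by rw [← this]; group
        exact (mul_left_cancel h3).symm
      rwa [h2] at hy
  have hL : ((Q : Subgroup G) ⊔ N).Normal := by
    have hsur := QuotientGroup.mk'_surjective N
    have hnorm := ((Group.isNilpotent_of_finite_tfae (G := G ⧸ N)).out 0 3 rfl rfl).1 hq p hp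
      (Q.mapSurjective hsur)
    rw [Sylow.coe_mapSurjective] at hnorm
    have := hnorm.comap (QuotientGroup.mk' N)
    rwa [Subgroup.comap_map_eq, QuotientGroup.ker_mk'] at this
  have hLn : (Q : Subgroup G) ⊔ N ≤ Subgroup.normalizer (Q : Set G) :=
    sup_le Subgroup.le_normalizer hXQ
  -- Frattini argument: `Q` is Sylow in the normal subgroup `QN`, so `G` is the product of `QN` and
  -- the normalizer of `Q`, which already contains `QN`.
  have htop := Sylow.normalizer_sup_eq_top' Q (N := (Q : Subgroup G) ⊔ N) le_sup_left
  rw [← Subgroup.normalizer_eq_top_iff]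
  rw [← htop]
  exact (sup_eq_left.2 hLn).symm

theorem Group.isNilpotent_quotient_gammaStar (j : ℕ) (G : Type*) [Group G] [Finite G] :
    Group.IsNilpotent (G ⧸ gammaStar G (j + 1)) := by
  induction j generalizing G with
  | zero =>
    have h : gammaStar G 1 = ⊤ := Subgroup.closure_univ
    have : Subsingleton (G ⧸ gammaStar G (0 + 1)) := by
      rw [zero_add, h]; exact QuotientGroup.subsingleton_quotient_top
    infer_instance
  | succ j ih =>
    refine Group.isNilpotent_of_forall_commute (gammaStarCommutators _ (j + 1))
      (fun x hx g => gammaStarCommutators_conj _ hx g) ?_ (gammaStar _ (j + 1)) rfl (ih _)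
    intro x hx a ha b hab
    rw [← commutatorElement_eq_one_iff_commute]
    have hmem : ⁅a, b⁆ ∈ gammaStarCommutators (G ⧸ gammaStar G (j + 2)) (j + 2) :=
      ⟨x, hx, a, ha, b, hab, rfl⟩
    obtain ⟨g, hg, hgx⟩ := exists_gammaStarCommutators_map_eq
      (QuotientGroup.mk' (gammaStar G (j + 2))) (QuotientGroup.mk'_surjective _) _ hmem
    rw [← hgx]
    exact (QuotientGroup.eq_one_iff _).2 (Subgroup.subset_closure hg)

theorem gammaStar_eq_gammaInfty (j : ℕ) (G : Type*) [Group G] [Finite G] :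
    gammaStar G (j + 2) = gammaInfty G := by
  apply le_antisymm
  · refine le_iInf fun n => (Subgroup.closure_le _).2 ?_
    rintro _ ⟨y, -, a, -, b, hab, rfl⟩
    let L := (⊤ : Subgroup G).lowerCentralSeries n
    have hnil : Group.IsNilpotent (G ⧸ L) := by
      rw [Subgroup.nilpotent_iff_lowerCentralSeries]
      refine ⟨n, ?_⟩
      rw [← Subgroup.map_top_of_surjective _ (QuotientGroup.mk'_surjective L),
        ← Subgroup.map_lowerCentralSeries]
      rw [Subgroup.map_eq_bot_iff, QuotientGroup.ker_mk']
    have hc := Group.commute_of_coprime_orderOf (G := G ⧸ L) (a := QuotientGroup.mk' L a)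
      (b := QuotientGroup.mk' L b)
      (Nat.Coprime.coprime_dvd_left (orderOf_map_dvd _ _)
        (Nat.Coprime.coprime_dvd_right (orderOf_map_dvd _ _) hab))
    rw [← commutatorElement_eq_one_iff_commute, ← map_commutatorElement] at hc
    exact (QuotientGroup.eq_one_iff _).1 hc
  · have hnil := Group.isNilpotent_quotient_gammaStar (j + 1) G
    obtain ⟨n, hn⟩ := Subgroup.nilpotent_iff_lowerCentralSeries.1 hnil
    refine (iInf_le _ n).trans ?_
    rw [← Subgroup.map_top_of_surjective _ (QuotientGroup.mk'_surjective _),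
        ← Subgroup.map_lowerCentralSeries] at hn
    rwa [Subgroup.map_eq_bot_iff, QuotientGroup.ker_mk'] at hn

/-! ### Cyclicity criteria and the pigeonhole on cyclic subgroups. -/

theorem mem_zpowers_of_orderOf_dvd {C : Type*} [Group C] [Finite C] [IsCyclic C] {x y : C}
    (h : orderOf x ∣ orderOf y) : x ∈ Subgroup.zpowers y := by
  classical
  have := Fintype.ofFinite C
  have hle := IsCyclic.card_pow_eq_one_le (α := C) (orderOf_pos y)
  have hsub : (Finset.univ.filter fun z => z ∈ Subgroup.zpowers y) ⊆
      Finset.univ.filter fun z : C => z ^ orderOf y = 1 := by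
    intro z hz
    obtain ⟨k, rfl⟩ := (Finset.mem_filter.1 hz).2
    have h1 : (y ^ k) ^ orderOf y = 1 := by
      rw [← zpow_natCast, ← zpow_mul, mul_comm, zpow_mul, zpow_natCast, pow_orderOf_eq_one,
        one_zpow]
    simp [h1]
  have hcard : (Finset.univ.filter fun z => z ∈ Subgroup.zpowers y).card = orderOf y := by
    rw [← Nat.card_zpowers, ← Fintype.card_subtype, Nat.card_eq_fintype_card]
  have heq := Finset.eq_of_subset_of_card_le hsub (by rw [hcard]; exact hle)
  have hx : x ∈ Finset.univ.filter fun z : C => z ^ orderOf y = 1 := by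
    simpa using orderOf_dvd_iff_pow_eq_one.1 h
  rw [← heq] at hx
  exact (Finset.mem_filter.1 hx).2

theorem Subgroup.mem_zpowers_of_orderOf_dvd {G : Type*} [Group G] [Finite G] {C : Subgroup G}
    (hC : IsCyclic C) {x y : G} (hx : x ∈ C) (hy : y ∈ C) (h : orderOf x ∣ orderOf y) :
    x ∈ Subgroup.zpowers y := by
  have := _root_.mem_zpowers_of_orderOf_dvd (C := C) (x := ⟨x, hx⟩) (y := ⟨y, hy⟩) (by simpa using h)
  obtain ⟨k, hk⟩ := this
  exact ⟨k, by simpa [Subtype.ext_iff] using hk⟩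

theorem Subgroup.card_le_prime_of_forall_mem_cyclic {G : Type*} [Group G] [Finite G]
    (p : ℕ) [hp : Fact p.Prime] (T : Subgroup G) (hT : ∀ x ∈ T, x ^ p = 1)
    (h : ∀ x ∈ T, ∀ y ∈ T, ∃ C : Subgroup G, IsCyclic C ∧ x ∈ C ∧ y ∈ C) : Nat.card T ≤ p := by
  by_cases hbot : T = ⊥
  · subst hbot
    simpa using hp.out.one_lt.le
  obtain ⟨y, hy1⟩ := Subgroup.ne_bot_iff_exists_ne_one.1 hbot
  have hoy : orderOf (y : G) = p := orderOf_eq_prime (hT y y.2) (by simpa using hy1)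
  have hle : T ≤ Subgroup.zpowers (y : G) := by
    intro x hx
    obtain ⟨C, hC, hxC, hyC⟩ := h x hx y y.2
    exact Subgroup.mem_zpowers_of_orderOf_dvd hC hxC hyC
      (by rw [hoy]; exact orderOf_dvd_of_pow_eq_one (hT x hx))
  calc Nat.card T ≤ Nat.card (Subgroup.zpowers (y : G)) := Subgroup.card_le_of_le hle
    _ = p := by rw [Nat.card_zpowers, hoy]

/-- Two of the `m + 1` elements `b * c ^ i`, `0 ≤ i ≤ m`, lie in the same `C l`. Their quotient is a
power of `c` with exponent between `1` and `m`, which divides `m!`; eliminating `c` then yields the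
same power of `b`. -/
theorem exists_pow_factorial_mem {G : Type*} [Group G] {m : ℕ} (C : Fin m → Subgroup G) {b c : G}
    (hbc : Commute b c) (h : ∀ i : ℕ, b * c ^ i ∈ ⋃ l, (C l : Set G)) :
    ∃ l, b ^ m ! ∈ C l ∧ c ^ m ! ∈ C l := by
  have h' (i : Fin (m + 1)) : ∃ l, b * c ^ (i : ℕ) ∈ C l := by simpa using h i
  choose F hF using h'
  obtain ⟨i, j, hij, hFij⟩ := Fintype.exists_ne_map_eq_of_card_lt F (by simp)
  wlog hlt : i < j generalizing i j
  · exact this j i hij.symm hFij.symm (lt_of_le_of_ne (not_lt.1 hlt) hij.symm)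
  obtain ⟨d, hd⟩ := Nat.exists_eq_add_of_lt (Fin.lt_def.1 hlt)
  have hi := hF i
  have hj := hF j
  rw [← hFij, hd] at hj
  have hc : c ^ (d + 1) ∈ C (F i) := by
    have := mul_mem (inv_mem hi) hj
    rwa [show (b * c ^ (i : ℕ))⁻¹ * (b * c ^ ((i : ℕ) + d + 1)) = c ^ (d + 1) by
      rw [add_assoc, pow_add]; group] at this
  have hb : b ^ (d + 1) ∈ C (F i) := by
    have := mul_mem (pow_mem hi (d + 1)) (inv_mem (pow_mem hc i))
    rwa [(hbc.pow_right _).mul_pow, ← pow_mul, ← pow_mul, mul_comm (d + 1) (i : ℕ),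
      mul_inv_cancel_right] at this
  obtain ⟨e, he⟩ : (d + 1) ∣ m ! := Nat.dvd_factorial (by omega) (by have := j.2; omega)
  exact ⟨F i, by rw [he, pow_mul]; exact pow_mem hb e, by rw [he, pow_mul]; exact pow_mem hc e⟩

theorem Subgroup.card_map_mul_card_inf_ker {G H : Type*} [Group G] [Group H] (f : G →* H)
    (W : Subgroup G) : Nat.card (W.map f) * Nat.card (W ⊓ f.ker : Subgroup G) = Nat.card W := by
  rw [← Subgroup.relIndex_ker, ← Subgroup.relIndex_bot_left, ← Subgroup.relIndex_bot_left,
    ← Subgroup.inf_relIndex_left, mul_comm]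
  exact Subgroup.relIndex_mul_relIndex _ _ _ bot_le inf_le_left

/-- The bound on the `n`-torsion is submultiplicative in `n`, so the prime case implies that `x ^ n
= 1` has at most `n` solutions for every `n > 0`. -/
theorem isCyclic_of_forall_prime_card_le {M : Type*} [CommGroup M] [Finite M]
    (h : ∀ p : ℕ, p.Prime → Nat.card (powMonoidHom p : M →* M).ker ≤ p) : IsCyclic M := by
  classical
  have := Fintype.ofFinite M
  have key : ∀ n : ℕ, 0 < n → Nat.card (powMonoidHom n : M →* M).ker ≤ n := by
    intro n
    induction n using Nat.recOnMul with
    | zero => simp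
    | one =>
      intro _
      have : (powMonoidHom 1 : M →* M) = MonoidHom.id M := by ext; simp
      rw [this, MonoidHom.ker_id]; simp
    | prime p hp => exact fun _ => h p hp
    | mul a b ha hb =>
      intro hab
      have ha0 : 0 < a := Nat.pos_of_ne_zero (by rintro rfl; simp at hab)
      have hb0 : 0 < b := Nat.pos_of_ne_zero (by rintro rfl; simp at hab)
      rw [← Subgroup.card_map_mul_card_inf_ker (powMonoidHom a : M →* M), mul_comm]
      refine Nat.mul_le_mul ((Subgroup.card_le_of_le inf_le_right).trans (ha ha0))
        ((Subgroup.card_le_of_le ?_).trans (hb hb0))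
      rintro _ ⟨x, hx, rfl⟩
      have hx' : x ^ (a * b) = 1 := hx
      change (x ^ a) ^ b = 1
      rwa [← pow_mul]
  refine isCyclic_of_card_pow_eq_one_le fun n hn => ?_
  have := key n hn
  rw [Nat.card_eq_fintype_card, Fintype.card_subtype] at this
  simpa [MonoidHom.mem_ker] using this

/-! ### Coprime action on an abelian group: displacements and norms. -/

section Action

variable {N : Type*} [CommGroup N] [Finite N]

/-- The endomorphism `w ↦ w * (k w)⁻¹` attached to an automorphism `k`. -/
def displacement {N : Type*} [CommGroup N] (k : MulAut N) : N →* N :=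
  MonoidHom.id N / k.toMonoidHom

theorem displacement_apply {N : Type*} [CommGroup N] (k : MulAut N) (w : N) :
    displacement k w = w / k w := rfl

open Classical in
/-- The product of the images under the elements of a group of automorphisms. -/
noncomputable def autNorm (K : Subgroup (MulAut N)) : N →* N :=
  have := Fintype.ofFinite K
  ∏ k : K, (k : MulAut N).toMonoidHom

theorem autNorm_apply (K : Subgroup (MulAut N)) [Fintype K] (x : N) :
    autNorm K x = ∏ k : K, (k : MulAut N) x := by
  rw [autNorm, MonoidHom.finsetProd_apply]
  congr!

theorem autNorm_apply_smul (K : Subgroup (MulAut N)) {k : MulAut N} (hk : k ∈ K) (x : N) :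
    autNorm K (k x) = autNorm K x := by
  have := Fintype.ofFinite K
  rw [autNorm_apply, autNorm_apply]
  exact Fintype.prod_equiv (Equiv.mulRight (⟨k, hk⟩ : K)) _ _ fun l => rfl

theorem autNorm_eq_pow (K : Subgroup (MulAut N)) {x : N} (hx : ∀ k ∈ K, k x = x) :
    autNorm K x = x ^ Nat.card K := by
  have := Fintype.ofFinite K
  rw [autNorm_apply, Nat.card_eq_fintype_card, ← Finset.card_univ]
  exact Finset.prod_eq_pow_card fun k _ => hx k k.2

theorem autNorm_displacement (K : Subgroup (MulAut N)) {k : MulAut N} (hk : k ∈ K) (x : N) :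
    autNorm K (displacement k x) = 1 := by
  rw [displacement_apply, map_div, autNorm_apply_smul K hk, div_self']

theorem pow_card_div_autNorm (K : Subgroup (MulAut N)) (x : N) :
    x ^ Nat.card K / autNorm K x ∈ Subgroup.closure {y | ∃ k ∈ K, y = displacement k x} := by
  have := Fintype.ofFinite K
  rw [autNorm_apply, Nat.card_eq_fintype_card, ← Finset.card_univ,
    ← Finset.prod_const x, ← Finset.prod_div_distrib]
  refine Subgroup.prod_mem _ fun k _ => Subgroup.subset_closure ⟨k, k.2, rfl⟩

theorem mem_of_pow_mem_of_coprime {G : Type*} [Group G] (H : Subgroup G) {x : G} {p s : ℕ}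
    (hx : x ^ p = 1) (hs : s.Coprime p) (h : x ^ s ∈ H) : x ∈ H := by
  obtain ⟨t, ht⟩ := exists_pow_eq_self_of_coprime
    (hs.coprime_dvd_right (orderOf_dvd_of_pow_eq_one hx))
  rw [← ht]
  exact pow_mem h t

/-- Two automorphisms generating a `p'`-group whose displacements on an elementary abelian
`p`-group `W` and the displacement of whose product have order at most `p` have the same
displacement subgroups, unless one of these is trivial. -/
theorem map_displacement_eq (p : ℕ) [hp : Fact p.Prime] (K : Subgroup (MulAut N))
    (hK : (Nat.card K).Coprime p) (W : Subgroup N) (hWK : ∀ k ∈ K, ∀ w ∈ W, k w ∈ W)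
    (hWp : ∀ w ∈ W, w ^ p = 1)
    (hd : ∀ k ∈ K, Nat.card (W.map (displacement k)) ≤ p) {h k : MulAut N} (hh : h ∈ K)
    (hk : k ∈ K) (hh1 : W.map (displacement h) ≠ ⊥) (hk1 : W.map (displacement k) ≠ ⊥) :
    W.map (displacement h) = W.map (displacement k) := by
  have hIW : ∀ l ∈ K, W.map (displacement l) ≤ W := by
    rintro l hl _ ⟨w, hw, rfl⟩
    exact div_mem hw (hWK l hl w hw)
  have hIz : ∀ l ∈ K, ∀ x ∈ W.map (displacement l), x ≠ 1 →
      Subgroup.zpowers x = W.map (displacement l) := by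
    intro l hl x hx hx1
    refine Subgroup.eq_of_le_of_card_ge (Subgroup.zpowers_le.2 hx) ?_
    rw [Nat.card_zpowers, orderOf_eq_prime (hWp x (hIW l hl hx)) hx1]
    exact hd l hl
  have hIp : ∀ l ∈ K, W.map (displacement l) ≠ ⊥ → Nat.card (W.map (displacement l)) = p := by
    intro l hl hl1
    obtain ⟨x, hx⟩ := Subgroup.ne_bot_iff_exists_ne_one.1 hl1
    rw [← hIz l hl x x.2 (by simpa using hx), Nat.card_zpowers]
    exact orderOf_eq_prime (hWp x (hIW l hl x.2)) (by simpa using hx)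
  by_contra hne
  have hdisj : ∀ x ∈ W.map (displacement h), x ∈ W.map (displacement k) → x = 1 := by
    intro x hx hx'
    by_contra hx1
    exact hne ((hIz h hh x hx hx1).symm.trans (hIz k hk x hx' hx1))
  -- If `h (k w) = w`, then `w / k w` is the inverse of the displacement of `k w` under `h`, so it
  -- lies in both displacement subgroups and is trivial. Counting then forces `h`, `k` and `h * k`
  -- to have the same fixed points in `W`.
  have hfix : ∀ w ∈ W, h (k w) = w → h w = w ∧ k w = w := by
    intro w hw hhk
    have hu : displacement k w = 1 := by
      refine hdisj _ ?_ ⟨w, hw, rfl⟩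
      have h1 : displacement k w = (displacement h (k w))⁻¹ := by
        rw [displacement_apply, displacement_apply, hhk, inv_div]
      rw [h1]
      exact inv_mem ⟨k w, hWK k hk w hw, rfl⟩
    rw [displacement_apply, div_eq_one] at hu
    rw [← hu] at hhk
    exact ⟨hhk, hu.symm⟩
  have hker : ∀ l : MulAut N, ∀ w, w ∈ W ⊓ (displacement l).ker ↔ w ∈ W ∧ l w = w := by
    intro l w
    rw [Subgroup.mem_inf, MonoidHom.mem_ker, displacement_apply, div_eq_one, eq_comm]
  have hpp := hp.out.pos
  have hcard : Nat.card W ≤ p * Nat.card (W ⊓ (displacement (h * k)).ker : Subgroup N) := by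
    rw [← Subgroup.card_map_mul_card_inf_ker (displacement (h * k)) W]
    exact Nat.mul_le_mul_right _ (hd _ (mul_mem hh hk))
  have hfixeq : ∀ l ∈ K, W.map (displacement l) ≠ ⊥ →
      (∀ w ∈ W, h (k w) = w → l w = w) →
      W ⊓ (displacement (h * k)).ker = W ⊓ (displacement l).ker := by
    intro l hl hl1 hlw
    refine Subgroup.eq_of_le_of_card_ge ?_ ?_
    · intro w hw
      rw [hker] at hw ⊢
      exact ⟨hw.1, hlw w hw.1 hw.2⟩
    · rw [← Subgroup.card_map_mul_card_inf_ker (displacement l) W, hIp l hl hl1] at hcard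
      exact Nat.le_of_mul_le_mul_left hcard hpp
  have hUh := hfixeq h hh hh1 fun w hw e => (hfix w hw e).1
  have hUk := hfixeq k hk hk1 fun w hw e => (hfix w hw e).2
  let K₀ : Subgroup (MulAut N) := Subgroup.closure {h, k}
  have hK₀ : K₀ ≤ K := (Subgroup.closure_le _).2 (by
    rintro x (rfl | rfl)
    exacts [hh, hk])
  have hcop : (Nat.card K₀).Coprime p := hK.coprime_dvd_left (Subgroup.card_dvd_of_le hK₀)
  have hhK₀ : h ∈ K₀ := Subgroup.subset_closure (by simp)
  have hkK₀ : k ∈ K₀ := Subgroup.subset_closure (by simp)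
  -- `T` kills these fixed points, so its image of `W` has order at most `p`. On displacements it is
  -- the `|K₀|`-th power, which is invertible on `W`; hence the image contains both displacement
  -- subgroups.
  let T : N →* N := powMonoidHom (Nat.card K₀) / autNorm K₀
  have hT (x : N) : T x = x ^ Nat.card K₀ / autNorm K₀ x := rfl
  have hUT : W ⊓ (displacement h).ker ≤ W ⊓ T.ker := by
    intro w hw
    have hw' := hw
    rw [← hUh, hUk, hker] at hw'
    rw [hker] at hw
    refine ⟨hw.1, ?_⟩
    change T w = 1
    rw [hT, autNorm_eq_pow, div_self']
    have hle : K₀ ≤ MulAction.stabilizer (MulAut N) w := (Subgroup.closure_le _).2 (by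
      rintro x (rfl | rfl)
      exacts [hw.2, hw'.2])
    exact fun l hl => hle hl
  have hTcard : Nat.card (W.map T) ≤ p := by
    have h1 := Subgroup.card_map_mul_card_inf_ker T W
    rw [← Subgroup.card_map_mul_card_inf_ker (displacement h) W, hIp h hh hh1] at h1
    have h2 := Subgroup.card_le_of_le hUT
    have h3 : 0 < Nat.card (W ⊓ (displacement h).ker : Subgroup N) := Nat.card_pos
    refine Nat.le_of_mul_le_mul_right ((Nat.mul_le_mul_left _ h2).trans h1.le) h3
  have hIT : ∀ l ∈ K, l ∈ K₀ → W.map (displacement l) ≠ ⊥ →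
      W.map (displacement l) = W.map T := by
    intro l hl hlK₀ hl1
    refine Subgroup.eq_of_le_of_card_ge ?_ (by rwa [hIp l hl hl1])
    intro x hx
    refine mem_of_pow_mem_of_coprime _ (hWp x (hIW l hl hx)) hcop ⟨x, hIW l hl hx, ?_⟩
    obtain ⟨w, hw, rfl⟩ := hx
    rw [hT, autNorm_displacement K₀ hlK₀, div_one]
  exact hne ((hIT h hh hhK₀ hh1).trans (hIT k hk hkK₀ hk1).symm)

/-- All displacements of `W` lie in one subgroup `L` of order at most `p`. When the norm of `w`
vanishes, `w ^ |K|` is a product of displacements, and `|K|` is prime to `p`. -/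
theorem card_le_of_card_map_displacement_le (p : ℕ) [hp : Fact p.Prime] (K : Subgroup (MulAut N))
    (hK : (Nat.card K).Coprime p) (W : Subgroup N) (hWK : ∀ k ∈ K, ∀ w ∈ W, k w ∈ W)
    (hWp : ∀ w ∈ W, w ^ p = 1)
    (hd : ∀ k ∈ K, Nat.card (W.map (displacement k)) ≤ p) (hE : ∀ w ∈ W, autNorm K w = 1) :
    Nat.card W ≤ p := by
  obtain ⟨L, hL, hLW⟩ : ∃ L : Subgroup N, Nat.card L ≤ p ∧
      ∀ k ∈ K, W.map (displacement k) ≤ L := by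
    by_cases hall : ∀ k ∈ K, W.map (displacement k) = ⊥
    · exact ⟨⊥, by simpa using hp.out.one_lt.le, fun k hk => (hall k hk).le⟩
    · push Not at hall
      obtain ⟨h, hh, hh1⟩ := hall
      refine ⟨_, hd h hh, fun k hk => ?_⟩
      by_cases hk1 : W.map (displacement k) = ⊥
      · rw [hk1]; exact bot_le
      · exact (map_displacement_eq p K hK W hWK hWp hd hk hh hk1 hh1).le
  refine (Subgroup.card_le_of_le fun w hw => ?_).trans hL
  refine mem_of_pow_mem_of_coprime L (hWp w hw) hK ?_
  have h1 := pow_card_div_autNorm K w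
  rw [hE w hw, div_one] at h1
  refine (Subgroup.closure_le _).2 ?_ h1
  rintro _ ⟨k, hk, rfl⟩
  exact hLW k hk ⟨w, hw, rfl⟩

end Action

/-- The Hall `p'`-subgroup: a Schur–Zassenhaus complement of the normal Sylow `p`-subgroup, itself
normal because the two commute. -/
theorem Group.exists_subgroup_mem_iff_coprime_orderOf {G : Type*} [Group G] [Finite G]
    [hG : Group.IsNilpotent G] (p : ℕ) [hp : Fact p.Prime] :
    ∃ K : Subgroup G, (Nat.card K).Coprime p ∧ ∀ x, x ∈ K ↔ (orderOf x).Coprime p := by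
  obtain ⟨Q⟩ : Nonempty (Sylow p G) := inferInstance
  have hQn : (Q : Subgroup G).Normal :=
    ((Group.isNilpotent_of_finite_tfae (G := G)).out 0 3 rfl rfl).1 hG p hp Q
  obtain ⟨k, hk⟩ := IsPGroup.iff_card.1 Q.2
  have hidx : ((Q : Subgroup G).index).Coprime p :=
    ((Nat.Prime.coprime_iff_not_dvd hp.out).2 Q.not_dvd_index).symm
  obtain ⟨K, hK⟩ := Subgroup.exists_right_complement'_of_coprime (N := (Q : Subgroup G))
    (by rw [hk]; exact (hidx.symm.pow_left k))
  have hKcard : Nat.card K = (Q : Subgroup G).index := hK.symm.index_eq_card.symm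
  have hKc : (Nat.card K).Coprime p := by rwa [hKcard]
  have hKo : ∀ x ∈ K, (orderOf x).Coprime p := fun x hx =>
    hKc.coprime_dvd_left (Subgroup.orderOf_dvd_natCard K hx)
  have hKn : K.Normal := by
    refine ⟨fun x hx g => ?_⟩
    obtain ⟨⟨q, l⟩, rfl⟩ := hK.surjective g
    have hcomm : Commute (q : G) (l * x * (l : G)⁻¹) := by
      apply Group.commute_of_coprime_orderOf
      obtain ⟨i, hi⟩ := (IsPGroup.iff_orderOf.1 Q.2) q
      have hi' : orderOf (q : G) = p ^ i := by rw [← hi]; exact Subgroup.orderOf_coe q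
      rw [hi']
      exact (hKo _ (mul_mem (mul_mem l.2 hx) (inv_mem l.2))).symm.pow_left i
    have : (q : G) * l * x * ((q : G) * l)⁻¹ = l * x * (l : G)⁻¹ := by
      calc (q : G) * l * x * ((q : G) * l)⁻¹ = q * (l * x * (l : G)⁻¹) * (q : G)⁻¹ := by group
        _ = _ := by rw [hcomm.eq, mul_inv_cancel_right]
    exact this ▸ mul_mem (mul_mem l.2 hx) (inv_mem l.2)
  refine ⟨K, hKc, fun x => ⟨hKo x, fun hx => ?_⟩⟩
  rw [← QuotientGroup.eq_one_iff, ← orderOf_eq_one_iff]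
  have h1 : orderOf (x : G ⧸ K) ∣ orderOf x := orderOf_map_dvd (QuotientGroup.mk' K) x
  have h2 : orderOf (x : G ⧸ K) ∣ p ^ k := by
    rw [← hk, ← hK.index_eq_card]
    exact orderOf_dvd_natCard _
  exact Nat.eq_one_of_dvd_coprimes (hx.pow_right k) h1 h2

section Displacement

variable {N : Type*} [CommGroup N] [Finite N]

/-- This is `[P,k,k] = [P,k]`. The norm of `⟨k⟩` kills displacements and is a `p'`-power on fixed
points, so no nontrivial element of `[P,k]` is fixed by `k` and the displacement is injective there.
-/
theorem map_displacement_map_displacement (p r : ℕ) (k : MulAut N)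
    (hk : (orderOf k).Coprime p) :
    (((powMonoidHom (p ^ r) : N →* N).ker.map (displacement k)).map (displacement k)) =
      (powMonoidHom (p ^ r) : N →* N).ker.map (displacement k) := by
  set P := (powMonoidHom (p ^ r) : N →* N).ker
  have hP : ∀ v ∈ P, displacement k v ∈ P := by
    intro v hv
    have hv' : v ^ p ^ r = 1 := hv
    change displacement k v ^ p ^ r = 1
    rw [← map_pow, hv', map_one]
  have hIP : P.map (displacement k) ≤ P := by
    rintro _ ⟨v, hv, rfl⟩
    exact hP v hv
  refine Subgroup.eq_of_le_of_card_ge (Subgroup.map_mono hIP) ?_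
  rw [← Subgroup.card_map_mul_card_inf_ker (displacement k) (P.map (displacement k))]
  have hbot : P.map (displacement k) ⊓ (displacement k).ker = ⊥ := by
    rw [eq_bot_iff]
    rintro _ ⟨⟨v, hv, rfl⟩, hy⟩
    have hy' : displacement k (displacement k v) = 1 := hy
    rw [displacement_apply, div_eq_one] at hy'
    have h1 := autNorm_displacement (Subgroup.zpowers k) (Subgroup.mem_zpowers k) v
    rw [autNorm_eq_pow, Nat.card_zpowers] at h1
    · exact mem_of_pow_mem_of_coprime ⊥ (hP v hv) (hk.pow_right r) h1
    · have hle : Subgroup.zpowers k ≤ MulAction.stabilizer (MulAut N) (displacement k v) :=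
        Subgroup.zpowers_le.2 hy'.symm
      exact fun l hl => hle hl
  rw [hbot, Subgroup.card_bot, mul_one]

end Displacement

/-! ### Cyclicity of the `m!`-th powers when `γ_j^*(G)` is abelian. -/

section AbelianGammaStar

open scoped IsMulCommutative

theorem coe_displacement_conjNormal {G : Type*} [Group G] {N : Subgroup G} [N.Normal]
    [IsMulCommutative N] (h : G) (v : N) : ((displacement (MulAut.conjNormal h) v : N) : G) = ⁅(v : G), h⁆ := by
  rw [displacement_apply, Subgroup.coe_div, MulAut.conjNormal_apply, commutatorElement_def,
    div_eq_mul_inv]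
  group

variable {G : Type*} [Group G] [Finite G]

/-- The element `(n b)^i b^{-i}` is a product of `i` conjugates of `n` by powers of `b`, so its norm
is the `i`-th power of that of `n`. As `n b` is conjugate to `b`, it is trivial for `i = orderOf b`.
-/
theorem autNorm_pow_orderOf_eq_one {N : Subgroup G} [N.Normal] [IsMulCommutative N]
    (K : Subgroup (MulAut N)) {a b : G} {n : N} (hn : (n : G) = ⁅a, b⁆)
    (hb : MulAut.conjNormal b ∈ K) : autNorm K n ^ orderOf b = 1 := by
  have key (i : ℕ) : ∃ y : N, (y : G) = (n * b) ^ i * (b ^ i)⁻¹ ∧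
      autNorm K y = autNorm K n ^ i := by
    induction i with
    | zero => exact ⟨1, by simp, by simp⟩
    | succ i ih =>
      obtain ⟨y, hy, hyn⟩ := ih
      refine ⟨y * MulAut.conjNormal (b ^ i) n, ?_, ?_⟩
      · rw [Subgroup.coe_mul, hy, MulAut.conjNormal_apply, pow_succ, pow_succ]
        group
      · rw [map_mul, hyn, autNorm_apply_smul K, pow_succ]
        rw [map_pow]
        exact pow_mem hb i
  obtain ⟨y, hy, hyn⟩ := key (orderOf b)
  have h1 : ((n : G) * b) = a * b * a⁻¹ := by rw [hn, commutatorElement_def]; group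
  have h2 : y = 1 := by
    apply Subtype.ext
    rw [hy, h1, conj_pow, pow_orderOf_eq_one]
    simp
  rw [← hyn, h2, map_one]

theorem autNorm_eq_one {i : ℕ} [IsMulCommutative (gammaStar G (i + 2))]
    (p : ℕ) [hp : Fact p.Prime] (K : Subgroup (MulAut (gammaStar G (i + 2))))
    (hK : ∀ b : G, (orderOf b).Coprime p → MulAut.conjNormal b ∈ K) {w : gammaStar G (i + 2)}
    (hw : w ^ p = 1) : autNorm K w = 1 := by
  obtain ⟨k, q, hq, hcard⟩ := Nat.exists_eq_pow_mul_and_not_dvd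
    (Nat.card_pos (α := gammaStar G (i + 2))).ne' p hp.out.ne_one
  have hqp : q.Coprime p := ((Nat.Prime.coprime_iff_not_dvd hp.out).2 hq).symm
  -- In each generator `⁅a, b⁆` one of `a`, `b` has order prime to `p`, so the norm of the generator
  -- has order prime to `p` and `Φ` is trivial on the whole group.
  let Φ : gammaStar G (i + 2) →* gammaStar G (i + 2) := (powMonoidHom q).comp (autNorm K)
  have hle : gammaStar G (i + 2) ≤ Φ.ker.map (gammaStar G (i + 2)).subtype := by
    refine (Subgroup.closure_le _).2 fun x hx => ?_
    let n : gammaStar G (i + 2) := ⟨x, Subgroup.subset_closure hx⟩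
    obtain ⟨s, hs, hns⟩ : ∃ s : ℕ, s.Coprime p ∧ autNorm K n ^ s = 1 := by
      obtain ⟨y, -, a, -, b, hab, hxab⟩ := hx
      by_cases hb : (orderOf b).Coprime p
      · exact ⟨_, hb, autNorm_pow_orderOf_eq_one K (n := n) hxab (hK b hb)⟩
      · have ha : (orderOf a).Coprime p := by
          rw [Nat.coprime_comm, Nat.Prime.coprime_iff_not_dvd hp.out, not_not] at hb
          exact hab.coprime_dvd_right hb
        refine ⟨_, ha, ?_⟩
        have h1 := autNorm_pow_orderOf_eq_one K (n := n⁻¹) (a := b) (b := a)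
          (by rw [Subgroup.coe_inv, ← commutatorElement_inv]; exact congrArg _ hxab) (hK a ha)
        rwa [map_inv, inv_pow, inv_eq_one] at h1
    refine ⟨n, ?_, rfl⟩
    change autNorm K n ^ q = 1
    rw [← orderOf_dvd_iff_pow_eq_one]
    have h1 : orderOf (autNorm K n) ∣ p ^ k * q := hcard ▸ orderOf_dvd_natCard _
    exact Nat.Coprime.dvd_of_dvd_mul_left
      ((hs.coprime_dvd_left (orderOf_dvd_of_pow_eq_one hns)).pow_right k) h1
  obtain ⟨w', hw', hww'⟩ := hle w.2
  rw [← Subtype.ext hww']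
  have hw1 : autNorm K w' ^ q = 1 := hw'
  have hw2 : autNorm K w' ^ p = 1 := by
    rw [show w' = w from Subtype.ext hww', ← map_pow, hw, map_one]
  exact mem_of_pow_mem_of_coprime ⊥ hw2 hqp hw1

/-- Since `[I,h] = I`, each element of `I` is `[y,h]` with `y` in `I`, of order prime to that of
`h`. Induction shows that `I` consists of `γ_j^*`-commutators for every `j`. -/
theorem gammaStar_displacement_mem {i : ℕ} [IsMulCommutative (gammaStar G (i + 2))]
    (p r : ℕ) {h : G} (hh : (orderOf h).Coprime p) {v : gammaStar G (i + 2)}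
    (hv : v ^ p ^ r = 1) :
    ((displacement (MulAut.conjNormal h) v : gammaStar G (i + 2)) : G) ∈
      gammaStarCommutators G (i + 2) := by
  have hk : (orderOf (MulAut.conjNormal h : MulAut (gammaStar G (i + 2)))).Coprime p :=
    hh.coprime_dvd_left (orderOf_map_dvd _ _)
  have hI := map_displacement_map_displacement p r _ hk
  set k : MulAut (gammaStar G (i + 2)) := MulAut.conjNormal h with hkdef
  set I := (powMonoidHom (p ^ r) : gammaStar G (i + 2) →* gammaStar G (i + 2)).ker.map
    (displacement k)
  suffices H : ∀ j : ℕ, ∀ x ∈ I, (x : G) ∈ gammaStarCommutators G (j + 1) from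
    H (i + 1) _ ⟨v, hv, rfl⟩
  intro j
  induction j with
  | zero => exact fun _ _ => trivial
  | succ j ih =>
    intro x hx
    rw [← hI] at hx
    obtain ⟨y, hy, rfl⟩ := hx
    refine ⟨y, ih y hy, y, Subgroup.mem_zpowers _, h, ?_, coe_displacement_conjNormal h y⟩
    obtain ⟨z, hz, rfl⟩ := hy
    have hz' : z ^ p ^ r = 1 := hz
    refine Nat.Coprime.coprime_dvd_left (orderOf_dvd_of_pow_eq_one (n := p ^ r) ?_)
      (hh.symm.pow_left r)
    rw [← Subgroup.coe_pow, ← map_pow, hz', map_one, Subgroup.coe_one]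

theorem isCyclic_range_pow_of_isMulCommutative {m i : ℕ} [IsMulCommutative (gammaStar G (i + 1))]
    (C : Fin m → Subgroup G) (hC : ∀ l, IsCyclic (C l))
    (hcov : gammaStarCommutators G (i + 1) ⊆ ⋃ l, (C l : Set G)) :
    IsCyclic (powMonoidHom (m !) : gammaStar G (i + 1) →* gammaStar G (i + 1)).range := by
  refine isCyclic_of_forall_prime_card_le fun p hp => ?_
  have := Fact.mk hp
  set R := (powMonoidHom (m !) : gammaStar G (i + 1) →* gammaStar G (i + 1)).range
  let W : Subgroup (gammaStar G (i + 1)) := (powMonoidHom p).ker ⊓ R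
  have hW : Nat.card (powMonoidHom p : R →* R).ker ≤ Nat.card W := by
    refine Nat.card_le_card_of_injective
      (fun x => (⟨x.1.1, ?_, x.1.2⟩ : W)) fun x y hxy => ?_
    · have h1 : x.1 ^ p = 1 := x.2
      exact congrArg Subtype.val h1
    · exact Subtype.ext (Subtype.ext (congrArg (fun z : W => (z : gammaStar G (i + 1))) hxy))
  refine hW.trans ?_
  have hWp : ∀ w ∈ W, w ^ p = 1 := fun w hw => hw.1
  -- For `j = 1` every element of `G` is covered, so the pigeonhole applies directly.
  rcases i with _ | i
  · refine Subgroup.card_le_prime_of_forall_mem_cyclic p W hWp ?_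
    rintro _ ⟨-, b, rfl⟩ _ ⟨-, c, rfl⟩
    obtain ⟨l, hb, hc⟩ := exists_pow_factorial_mem C
      (show Commute (b : G) c from congrArg Subtype.val (mul_comm b c)) (fun i => hcov trivial)
    refine ⟨(C l).subgroupOf _, ?_, hb, hc⟩
    have := hC l
    exact isCyclic_of_injective (((gammaStar G (0 + 1)).subtype).subgroupComap (C l))
      fun x y hxy => Subtype.ext (Subtype.ext (congrArg (fun z : C l => (z : G)) hxy))
  have hnil := Group.isNilpotent_quotient_gammaStar (i + 1) G
  let ρ : G →* MulAut (gammaStar G (i + 2)) := MulAut.conjNormal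
  have hρ : gammaStar G (i + 2) ≤ ρ.ker := by
    intro x hx
    refine MulEquiv.ext fun y => Subtype.ext ?_
    rw [MulAut.conjNormal_apply]
    have hxy : x * y = y * x := congrArg Subtype.val (mul_comm (⟨x, hx⟩ : gammaStar G (i + 2)) y)
    rw [hxy, mul_inv_cancel_right]
    rfl
  have hΓ : Group.IsNilpotent ρ.range :=
    Group.nilpotent_of_surjective (QuotientGroup.lift _ ρ.rangeRestrict
      (fun x hx => Subtype.ext (hρ hx)))
      (QuotientGroup.lift_surjective_of_surjective _ _ ρ.rangeRestrict_surjective _)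
  obtain ⟨K₁, hK₁, hmem⟩ := Group.exists_subgroup_mem_iff_coprime_orderOf (G := ρ.range) p
  let K := K₁.map ρ.range.subtype
  have hKcard : (Nat.card K).Coprime p := by
    rwa [Subgroup.card_map_of_injective ρ.range.subtype_injective]
  have hlift : ∀ k ∈ K, ∃ h : G, (orderOf h).Coprime p ∧ ρ h = k := by
    rintro _ ⟨⟨_, g, rfl⟩, hg, rfl⟩
    obtain ⟨h, -, hhg, hd⟩ := exists_mem_zpowers_map_eq_and_prime_dvd ρ.rangeRestrict g
    refine ⟨h, ?_, congrArg Subtype.val hhg⟩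
    exact coprime_of_prime_dvd ((hmem _).1 hg) hd (fun _ _ h => h)
  have hKb : ∀ b : G, (orderOf b).Coprime p → ρ b ∈ K := by
    intro b hb
    exact ⟨ρ.rangeRestrict b, (hmem _).2 (hb.coprime_dvd_left (orderOf_map_dvd _ _)), rfl⟩
  refine card_le_of_card_map_displacement_le p K hKcard W ?_ hWp ?_
    fun w hw => autNorm_eq_one p K hKb (hWp w hw)
  · rintro k - w ⟨hw, b, rfl⟩
    refine ⟨?_, k b, (map_pow k b _).symm⟩
    have hw' : (b ^ m !) ^ p = 1 := hw
    change (k (b ^ m !)) ^ p = 1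
    rw [← map_pow, hw', map_one]
  intro k hk
  obtain ⟨h, hh, rfl⟩ := hlift k hk
  obtain ⟨r, q, hq, hcard⟩ := Nat.exists_eq_pow_mul_and_not_dvd
    (Nat.card_pos (α := gammaStar G (i + 2))).ne' p hp.ne_one
  have hqp : q.Coprime p := ((Nat.Prime.coprime_iff_not_dvd hp).2 hq).symm
  -- An `m!`-th root of `w` can be chosen in the `p`-part of the group, where
  -- `gammaStar_displacement_mem` applies.
  have hroot : ∀ w ∈ W, ∃ v : gammaStar G (i + 2), v ^ p ^ r = 1 ∧ w = v ^ m ! := by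
    rintro _ ⟨hw, b, rfl⟩
    obtain ⟨t, ht⟩ := exists_pow_eq_self_of_coprime (x := b ^ m !)
      (hqp.coprime_dvd_right (orderOf_dvd_of_pow_eq_one hw))
    refine ⟨(b ^ q) ^ t, ?_, ?_⟩
    · rw [← pow_mul, ← pow_mul, show q * (t * p ^ r) = p ^ r * q * t by ring, ← hcard, pow_mul,
        pow_card_eq_one', one_pow]
    · change b ^ m ! = _
      conv_lhs => rw [← ht]
      simp only [← pow_mul]
      congr 1
      ring
  refine Subgroup.card_le_prime_of_forall_mem_cyclic p _ ?_ ?_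
  · rintro _ ⟨w, hw, rfl⟩
    rw [← map_pow, hWp w hw, map_one]
  rintro _ ⟨w₁, hw₁, rfl⟩ _ ⟨w₂, hw₂, rfl⟩
  obtain ⟨b, hb, rfl⟩ := hroot w₁ hw₁
  obtain ⟨c, hc, rfl⟩ := hroot w₂ hw₂
  obtain ⟨l, hbl, hcl⟩ := exists_pow_factorial_mem C
    (b := (displacement (ρ h) b : G)) (c := (displacement (ρ h) c : G))
    (congrArg Subtype.val (mul_comm (displacement (ρ h) b) (displacement (ρ h) c)))
    (fun e => hcov (by
      rw [← Subgroup.coe_pow, ← Subgroup.coe_mul, ← map_pow, ← map_mul]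
      refine gammaStar_displacement_mem p r hh ?_
      rw [mul_pow, hb, one_mul, ← pow_mul, mul_comm, pow_mul, hc, one_pow]))
  refine ⟨(C l).subgroupOf _, ?_, ?_, ?_⟩
  · have := hC l
    exact isCyclic_of_injective (((gammaStar G (i + 2)).subtype).subgroupComap (C l))
      fun x y hxy => Subtype.ext (Subtype.ext (congrArg (fun z : C l => (z : G)) hxy))
  · rw [map_pow]; exact hbl
  · rw [map_pow]; exact hcl

end AbelianGammaStar

/-! ### Order bounds from finite normal generating sets. -/

theorem Subgroup.card_closure_le_pow {A : Type*} [CommGroup A] [Finite A] {e : ℕ} (he : 0 < e)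
    (S : Finset A) (hS : ∀ x ∈ S, x ^ e = 1) :
    Nat.card (Subgroup.closure (S : Set A)) ≤ e ^ S.card := by
  classical
  induction S using Finset.induction_on with
  | empty => simp
  | insert x S hx ih =>
    rw [Finset.coe_insert, Set.insert_eq, Subgroup.closure_union, Finset.card_insert_of_notMem hx,
      pow_succ', ← Subgroup.zpowers_eq_closure]
    have h1 : Nat.card (Subgroup.zpowers x) ≤ e := by
      rw [Nat.card_zpowers]
      exact orderOf_le_of_pow_eq_one he (hS x (by simp))
    have h2 := ih fun y hy => hS y (by simp [hy])
    refine le_trans ?_ (Nat.mul_le_mul h1 h2)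
    have h3 := Set.natCard_mul_le (s := (Subgroup.zpowers x : Set A))
      (t := (Subgroup.closure (S : Set A) : Set A))
    rwa [← Subgroup.mul_normal] at h3

theorem cardCommutatorBound_mono {a b : ℕ} (ha : 0 < a) (hab : a ≤ b) :
    Subgroup.cardCommutatorBound a ≤ Subgroup.cardCommutatorBound b := by
  have hb : 0 < b := ha.trans_le hab
  unfold Subgroup.cardCommutatorBound
  have h1 : a ^ (2 * a) ≤ b ^ (2 * b) :=
    (Nat.pow_le_pow_left hab _).trans (Nat.pow_le_pow_right hb (by omega))
  have h2 : a ^ (2 * a + 1) ≤ b ^ (2 * b + 1) :=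
    (Nat.pow_le_pow_left hab _).trans (Nat.pow_le_pow_right hb (by omega))
  exact (Nat.pow_le_pow_left h1 _).trans (Nat.pow_le_pow_right (pow_pos hb _) (by omega))

theorem card_commutator_le_of_card_commutatorSet_le {G : Type*} [Group G] [Finite G] {k : ℕ}
    (h : Nat.card (commutatorSet G) ≤ k) :
    Nat.card (commutator G) ≤ Subgroup.cardCommutatorBound k :=
  (Subgroup.card_commutator_le_of_finite_commutatorSet G).trans
    (cardCommutatorBound_mono Nat.card_pos h)

theorem card_commutatorSet_le_sq_index {G : Type*} [Group G] [Finite G] (Z : Subgroup G)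
    (hZ : Z ≤ Subgroup.center G) : Nat.card (commutatorSet G) ≤ Z.index ^ 2 := by
  rw [pow_two, Subgroup.index, ← Nat.card_prod]
  refine Nat.card_le_card_of_surjective
    (fun q : (G ⧸ Z) × (G ⧸ Z) => (⟨⁅q.1.out, q.2.out⁆, _, _, rfl⟩ : commutatorSet G)) ?_
  rintro ⟨_, x, y, rfl⟩
  refine ⟨(x, y), Subtype.ext ?_⟩
  obtain ⟨⟨z, hzZ⟩, hz⟩ := QuotientGroup.mk_out_eq_mul Z x
  obtain ⟨⟨w, hwZ⟩, hw⟩ := QuotientGroup.mk_out_eq_mul Z y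
  have hzc := Subgroup.mem_center_iff.1 (hZ hzZ)
  have hwc := Subgroup.mem_center_iff.1 (hZ hwZ)
  change ⁅(x : G ⧸ Z).out, (y : G ⧸ Z).out⁆ = ⁅x, y⁆
  rw [hz, hw, commutatorElement_def, commutatorElement_def]
  calc x * z * (y * w) * (x * z)⁻¹ * (y * w)⁻¹
      = x * (z * y) * w * z⁻¹ * x⁻¹ * w⁻¹ * y⁻¹ := by group
    _ = x * y * (z * w) * z⁻¹ * x⁻¹ * w⁻¹ * y⁻¹ := by rw [← hzc y]; group
    _ = x * y * w * x⁻¹ * w⁻¹ * y⁻¹ := by rw [← hzc w]; group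
    _ = x * y * (w * x⁻¹) * w⁻¹ * y⁻¹ := by group
    _ = x * y * x⁻¹ * y⁻¹ := by rw [← hwc x⁻¹]; group

/-- A coset of the center is determined by its conjugation action on the generating set `Y`. -/
theorem index_center_le_of_closure {G : Type*} [Group G] [Finite G] (Y : Set G)
    (hY : ∀ y ∈ Y, ∀ g : G, g * y * g⁻¹ ∈ Y) (hgen : Subgroup.closure Y = ⊤) :
    (Subgroup.center G).index ≤ Y.ncard ^ Y.ncard := by
  have h1 : Nat.card (Y → Y) = Y.ncard ^ Y.ncard := by
    rw [Nat.card_fun, Nat.card_coe_set_eq]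
  rw [← h1, Subgroup.index]
  refine Nat.card_le_card_of_injective
    (fun q : G ⧸ Subgroup.center G => fun y : Y =>
      (⟨q.out * y * q.out⁻¹, hY y y.2 _⟩ : Y)) fun q r hqr => ?_
  have hle : Subgroup.closure Y ≤ Subgroup.centralizer {q.out⁻¹ * r.out} := by
    refine (Subgroup.closure_le _).2 fun y hy => ?_
    have h2 : q.out * y * q.out⁻¹ = r.out * y * r.out⁻¹ :=
      congrArg Subtype.val (congrFun hqr ⟨y, hy⟩)
    rw [SetLike.mem_coe, Subgroup.mem_centralizer_singleton_iff]
    calc y * (q.out⁻¹ * r.out) = q.out⁻¹ * (q.out * y * q.out⁻¹) * r.out := by group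
      _ = _ := by rw [h2]; group
  rw [hgen] at hle
  rw [← QuotientGroup.out_eq' q, ← QuotientGroup.out_eq' r, QuotientGroup.eq,
    Subgroup.mem_center_iff]
  exact fun g => Subgroup.mem_centralizer_singleton_iff.1 (hle (Subgroup.mem_top g))

/-- The bound of `card_le_finiteNormalBound`. -/
def finiteNormalBound (s n : ℕ) : ℕ := Subgroup.cardCommutatorBound ((s ^ s) ^ 2) * n ^ s

theorem card_le_finiteNormalBound {G : Type*} [Group G] [Finite G] (Y : Set G)
    (hY : ∀ y ∈ Y, ∀ g : G, g * y * g⁻¹ ∈ Y) (hgen : Subgroup.closure Y = ⊤) {s n : ℕ}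
    (hs : Y.ncard ≤ s) (hs0 : 0 < s) (hn : 0 < n) (hexp : ∀ g : G, g ^ n = 1) :
    Nat.card G ≤ finiteNormalBound s n := by
  classical
  rw [← Subgroup.index_mul_card (commutator G), mul_comm]
  refine Nat.mul_le_mul ?_ ?_
  · refine card_commutator_le_of_card_commutatorSet_le
      ((card_commutatorSet_le_sq_index _ le_rfl).trans (Nat.pow_le_pow_left ?_ 2))
    refine (index_center_le_of_closure Y hY hgen).trans ?_
    exact (Nat.pow_le_pow_left hs _).trans (Nat.pow_le_pow_right hs0 hs)
  · have hfin := Y.toFinite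
    let S : Finset (Abelianization G) := hfin.toFinset.image Abelianization.of
    have h1 : Subgroup.closure (S : Set (Abelianization G)) = ⊤ := by
      rw [Finset.coe_image, hfin.coe_toFinset, ← MonoidHom.map_closure, hgen,
        Subgroup.map_top_of_surjective]
      exact QuotientGroup.mk'_surjective _
    have h2 := Subgroup.card_closure_le_pow hn S fun x _ => by
      obtain ⟨g, rfl⟩ : ∃ g, Abelianization.of g = x := QuotientGroup.mk'_surjective _ x
      rw [← map_pow, hexp, map_one]
    rw [h1, Subgroup.card_top] at h2
    refine h2.trans (Nat.pow_le_pow_right hn (Finset.card_image_le.trans ?_))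
    rwa [← Set.ncard_eq_toFinset_card Y hfin]

theorem ncard_le_of_subset_iUnion_isCyclic {G : Type*} [Group G] [Finite G] {m n : ℕ}
    (C : Fin m → Subgroup G) (hC : ∀ l, IsCyclic (C l)) (hn : 0 < n) (Y : Set G)
    (hYC : Y ⊆ ⋃ l, (C l : Set G)) (hYn : ∀ y ∈ Y, y ^ n = 1) : Y.ncard ≤ m * n := by
  classical
  have := Fintype.ofFinite G
  let T (l : Fin m) : Finset G :=
    (Finset.univ.filter fun c : C l => c ^ n = 1).map (Function.Embedding.subtype _)
  have hsub : Y ⊆ (Finset.univ.biUnion T : Finset G) := by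
    intro y hy
    obtain ⟨l, hl⟩ := Set.mem_iUnion.1 (hYC hy)
    simp only [Finset.coe_biUnion, Set.mem_iUnion, T]
    refine ⟨l, by simp, ?_⟩
    simp only [Finset.coe_map, Set.mem_image, Finset.mem_coe, Finset.mem_filter]
    exact ⟨⟨y, hl⟩, ⟨by simp, Subtype.ext (hYn y hy)⟩, rfl⟩
  refine (Set.ncard_le_ncard hsub).trans ?_
  rw [Set.ncard_coe_finset]
  refine Finset.card_biUnion_le.trans ?_
  refine (Finset.sum_le_card_nsmul _ _ n fun l _ => ?_).trans (by simp)
  rw [Finset.card_map]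
  have := hC l
  exact IsCyclic.card_pow_eq_one_le hn

/-- The subgroup of elements of a finite group normalizing every cyclic subgroup generated by an
element of `X`. -/
def powerNormalizer {G : Type*} [Group G] [Finite G] (X : Set G) : Subgroup G where
  carrier := {g | ∀ x ∈ X, g * x * g⁻¹ ∈ Subgroup.zpowers x}
  one_mem' := fun x _ => by simp
  mul_mem' := by
    intro g h hg hh x hx
    obtain ⟨i, hi⟩ := hh x hx
    have h1 : g * h * x * (g * h)⁻¹ = (g * x * g⁻¹) ^ i := by
      rw [conj_zpow]
      change _ = g * (fun i => x ^ i) i * g⁻¹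
      rw [hi]
      group
    rw [h1]
    exact zpow_mem (hg x hx) i
  inv_mem' := by
    intro g hg x hx
    have hpow (k : ℕ) : g ^ k * x * (g ^ k)⁻¹ ∈ Subgroup.zpowers x := by
      induction k with
      | zero => simp
      | succ k ih =>
        obtain ⟨i, hi⟩ := ih
        have h1 : g ^ (k + 1) * x * (g ^ (k + 1))⁻¹ = (g * x * g⁻¹) ^ i := by
          rw [conj_zpow]
          change _ = g * (fun i => x ^ i) i * g⁻¹
          rw [hi, pow_succ']
          group
        rw [h1]
        exact zpow_mem (hg x hx) i
    have h2 : g⁻¹ = g ^ (orderOf g - 1) := by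
      rw [inv_eq_iff_mul_eq_one, ← pow_succ', Nat.sub_add_cancel (orderOf_pos g),
        pow_orderOf_eq_one]
    rw [h2]
    exact hpow _

/-! ### The subgroup normalizing all `⟨x⟩`, `x ∈ X`. -/

section PowerNormalizer

variable {G : Type*} [Group G] [Finite G] {X : Set G}

theorem powerNormalizer_normal (hX : ∀ x ∈ X, ∀ g : G, g * x * g⁻¹ ∈ X) :
    (powerNormalizer X).Normal := by
  refine ⟨fun g hg c x hx => ?_⟩
  obtain ⟨i, hi⟩ := hg _ (hX x hx c⁻¹)
  refine ⟨i, ?_⟩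
  have hi' : (c⁻¹ * x * c) ^ i = g * (c⁻¹ * x * c) * g⁻¹ := by simpa using hi
  have h1 : x ^ i = c * (c⁻¹ * x * c) ^ i * c⁻¹ := by
    rw [← conj_zpow]
    congr 1
    group
  change x ^ i = _
  rw [h1, hi']
  group

/-- Among the conjugates of `x` by `g ^ i`, `0 ≤ i ≤ m`, two lie in one cyclic `C l`. Having equal
orders they generate the same subgroup, so some `g ^ d` with `1 ≤ d ≤ m` normalizes `⟨x⟩`. -/
theorem pow_factorial_mem_powerNormalizer {m : ℕ} (C : Fin m → Subgroup G)
    (hC : ∀ l, IsCyclic (C l)) (hX : ∀ x ∈ X, ∀ g : G, g * x * g⁻¹ ∈ X)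
    (hXC : X ⊆ ⋃ l, (C l : Set G)) (g : G) : g ^ m ! ∈ powerNormalizer X := by
  intro x hx
  suffices H : g ^ m ! ∈ powerNormalizer {x} from H x rfl
  have h' (i : Fin (m + 1)) : ∃ l, g ^ (i : ℕ) * x * (g ^ (i : ℕ))⁻¹ ∈ C l := by
    simpa using hXC (hX x hx (g ^ (i : ℕ)))
  choose F hF using h'
  obtain ⟨i, j, hij, hFij⟩ := Fintype.exists_ne_map_eq_of_card_lt F (by simp)
  wlog hlt : i < j generalizing i j
  · exact this j i hij.symm hFij.symm (lt_of_le_of_ne (not_lt.1 hlt) hij.symm)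
  obtain ⟨d, hd⟩ := Nat.exists_eq_add_of_lt (Fin.lt_def.1 hlt)
  have hord (z : G) : orderOf (z * x * z⁻¹) = orderOf x := by
    rw [← MulAut.conj_apply]
    exact orderOf_injective (MulAut.conj z).toMonoidHom (MulAut.conj z).injective x
  obtain ⟨k, hk⟩ := Subgroup.mem_zpowers_of_orderOf_dvd (hC (F i)) (hFij ▸ hF j) (hF i)
    (by rw [hord, hord])
  have hmem : g ^ (d + 1) ∈ powerNormalizer {x} := by
    intro y hy
    rw [Set.mem_singleton_iff.1 hy]
    refine ⟨k, ?_⟩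
    have hk' : g ^ (i : ℕ) * x ^ k * (g ^ (i : ℕ))⁻¹ = g ^ (j : ℕ) * x * (g ^ (j : ℕ))⁻¹ := by
      rw [← conj_zpow]; exact hk
    rw [hd, add_assoc, pow_add g i] at hk'
    change x ^ k = _
    calc x ^ k = (g ^ (i : ℕ))⁻¹ * (g ^ (i : ℕ) * x ^ k * (g ^ (i : ℕ))⁻¹) * g ^ (i : ℕ) := by group
      _ = _ := by rw [hk']; group
  obtain ⟨e, he⟩ : (d + 1) ∣ m ! := Nat.dvd_factorial (by omega) (by have := j.2; omega)
  rw [he, pow_mul]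
  exact pow_mem hmem e

/-- Automorphisms of the cyclic group `⟨x⟩` commute, so these commutators centralize every
generator. -/
theorem commutator_powerNormalizer_le_center (hgen : Subgroup.closure X = ⊤) :
    ⁅powerNormalizer X, powerNormalizer X⁆ ≤ Subgroup.center G := by
  rw [Subgroup.commutator_le]
  intro k hk l hl
  have hle : Subgroup.closure X ≤ Subgroup.centralizer {⁅k, l⁆} := by
    refine (Subgroup.closure_le _).2 fun x hx => ?_
    obtain ⟨a, ha⟩ := inv_mem hk x hx
    obtain ⟨b, hb⟩ := inv_mem hl x hx
    have ha' : x ^ a = k⁻¹ * x * k⁻¹⁻¹ := ha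
    have hb' : x ^ b = l⁻¹ * x * l⁻¹⁻¹ := hb
    have h1 : k⁻¹ * l⁻¹ * x * (k⁻¹ * l⁻¹)⁻¹ = x ^ (a * b) := by
      rw [zpow_mul, ha', conj_zpow, hb']; group
    have h2 : l⁻¹ * k⁻¹ * x * (l⁻¹ * k⁻¹)⁻¹ = x ^ (a * b) := by
      rw [mul_comm, zpow_mul, hb', conj_zpow, ha']; group
    rw [SetLike.mem_coe, Subgroup.mem_centralizer_singleton_iff, commutatorElement_def]
    calc x * (k * l * k⁻¹ * l⁻¹)
        = (l⁻¹ * k⁻¹)⁻¹ * (l⁻¹ * k⁻¹ * x * (l⁻¹ * k⁻¹)⁻¹) * (k⁻¹ * l⁻¹) := by group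
      _ = k * l * k⁻¹ * l⁻¹ * x := by rw [h2, ← h1]; group
  rw [hgen] at hle
  rw [Subgroup.mem_center_iff]
  exact fun g => Subgroup.mem_centralizer_singleton_iff.1 (hle (Subgroup.mem_top g))

theorem index_powerNormalizer_le {m : ℕ} (C : Fin m → Subgroup G)
    (hC : ∀ l, IsCyclic (C l)) (hX : ∀ x ∈ X, ∀ g : G, g * x * g⁻¹ ∈ X)
    (hgen : Subgroup.closure X = ⊤) (hXC : X ⊆ ⋃ l, (C l : Set G)) :
    (powerNormalizer X).index ≤ finiteNormalBound (m * m ! + 1) (m !) := by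
  have hK := powerNormalizer_normal hX
  let π := QuotientGroup.mk' (powerNormalizer X)
  have hπ : Function.Surjective π := QuotientGroup.mk'_surjective _
  have hexp : ∀ g : G ⧸ powerNormalizer X, g ^ m ! = 1 := by
    intro g
    obtain ⟨g, rfl⟩ := hπ g
    rw [← map_pow]
    exact (QuotientGroup.eq_one_iff _).2 (pow_factorial_mem_powerNormalizer C hC hX hXC g)
  -- The quotient has exponent dividing `m!`, so each of the `m` cyclic images contributes at most
  -- `m!` elements; the `+ 1` keeps the bound positive when `m = 0`.
  refine card_le_finiteNormalBound (π '' X) ?_ ?_ ((ncard_le_of_subset_iUnion_isCyclic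
    (fun l => (C l).map π) ?_ (Nat.factorial_pos m) (π '' X) ?_ fun y _ => hexp y).trans
      (Nat.le_succ _)) (Nat.succ_pos _) (Nat.factorial_pos m) hexp
  · rintro _ ⟨x, hx, rfl⟩ g
    obtain ⟨g, rfl⟩ := hπ g
    exact ⟨_, hX x hx g, by simp⟩
  · rw [← MonoidHom.map_closure, hgen, Subgroup.map_top_of_surjective _ hπ]
  · intro l
    have := hC l
    exact isCyclic_of_surjective (π.subgroupMap (C l)) (π.subgroupMap_surjective (C l))
  · rintro _ ⟨x, hx, rfl⟩
    obtain ⟨l, hl⟩ := Set.mem_iUnion.1 (hXC hx)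
    exact Set.mem_iUnion.2 ⟨l, x, hl, rfl⟩

end PowerNormalizer

/-! ### Counting commutators. -/

theorem card_commutator_le_mul_quotient {G : Type*} [Group G] [Finite G] (R : Subgroup G)
    [R.Normal] : Nat.card (commutator G) ≤ Nat.card R * Nat.card (commutator (G ⧸ R)) := by
  have h1 : (commutator G).map (QuotientGroup.mk' R) = commutator (G ⧸ R) := by
    rw [commutator_def, commutator_def, Subgroup.map_commutator,
      Subgroup.map_top_of_surjective _ (QuotientGroup.mk'_surjective R)]
  rw [← Subgroup.card_map_mul_card_inf_ker (QuotientGroup.mk' R) (commutator G), h1, mul_comm,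
    QuotientGroup.ker_mk']
  exact Nat.mul_le_mul_right _ (Subgroup.card_le_of_le inf_le_right)

theorem commutatorElement_pow_eq_one {G : Type*} [Group G] {a x : G} {n : ℕ}
    (hx : ⁅a, x⁆ ∈ Subgroup.zpowers x) (hn : Commute a (x ^ n)) : ⁅a, x⁆ ^ n = 1 := by
  have hc : Commute ⁅a, x⁆ x := by
    obtain ⟨i, hi⟩ := hx
    rw [← hi]
    exact (Commute.refl x).zpow_left i
  have h1 : ⁅a, x⁆ * x = a * x * a⁻¹ := by rw [commutatorElement_def]; group
  have h2 : ⁅a, x⁆ ^ n * x ^ n = x ^ n := by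
    rw [← hc.mul_pow, h1, conj_pow, hn.eq, mul_inv_cancel_right]
  exact mul_eq_right.1 h2

/-- The commutators `⁅a, x⁆` lie in the covered set `⋃ ⟨x⟩` and have exponent `n` because `x ^ n ∈
A` commutes with `a`. So they are few and generate a bounded subgroup `R` of `A`; modulo `R`, `A` is
central of index at most `t`. -/
theorem card_commutator_le_of_abelian_normal {G : Type*} [Group G] [Finite G] {X : Set G}
    {m n t : ℕ} (C : Fin m → Subgroup G) (hC : ∀ l, IsCyclic (C l))
    (hX : ∀ x ∈ X, ∀ g : G, g * x * g⁻¹ ∈ X)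
    (hgen : Subgroup.closure X = ⊤) (hXC : X ⊆ ⋃ l, (C l : Set G))
    (A : Subgroup G) [hA : A.Normal] [IsMulCommutative A] (hAX : A ≤ powerNormalizer X)
    (hn : 0 < n) (hAn : ∀ g : G, g ^ n ∈ A) (ht : A.index ≤ t) :
    Nat.card (commutator G) ≤ n ^ (m * n) * Subgroup.cardCommutatorBound (t ^ 2) := by
  classical
  have hcomm : ∀ a ∈ A, ∀ b ∈ A, Commute a b := fun a ha b hb =>
    congrArg Subtype.val (mul_comm' (⟨a, ha⟩ : A) ⟨b, hb⟩)
  let S : Set G := {u | ∃ a ∈ A, ∃ x ∈ X, u = ⁅a, x⁆}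
  have hSz : ∀ a ∈ A, ∀ x ∈ X, ⁅a, x⁆ ∈ Subgroup.zpowers x := fun a ha x hx =>
    mul_mem (hAX ha x hx) (inv_mem (Subgroup.mem_zpowers x))
  have hSn : ∀ u ∈ S, u ^ n = 1 := by
    rintro _ ⟨a, ha, x, hx, rfl⟩
    exact commutatorElement_pow_eq_one (hSz a ha x hx) (hcomm a ha _ (hAn x))
  have hSA : S ⊆ A := by
    rintro _ ⟨a, ha, x, hx, rfl⟩
    have h1 : ⁅a, x⁆ = a * (x * a⁻¹ * x⁻¹) := by rw [commutatorElement_def]; group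
    rw [h1]
    exact mul_mem ha (hA.conj_mem _ (inv_mem ha) x)
  have hScard : S.ncard ≤ m * n := by
    refine ncard_le_of_subset_iUnion_isCyclic C hC hn S ?_ hSn
    rintro _ ⟨a, ha, x, hx, rfl⟩
    obtain ⟨l, hl⟩ := Set.mem_iUnion.1 (hXC hx)
    exact Set.mem_iUnion.2 ⟨l, Subgroup.zpowers_le.2 hl (hSz a ha x hx)⟩
  let R := Subgroup.closure S
  have hSconj : Group.conjugatesOfSet S = S := by
    refine Set.Subset.antisymm (fun z hz => ?_) Group.subset_conjugatesOfSet
    obtain ⟨y, ⟨a, ha, x, hx, rfl⟩, h⟩ := Group.mem_conjugatesOfSet_iff.1 hz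
    obtain ⟨g, rfl⟩ := isConj_iff.1 h
    refine ⟨_, hA.conj_mem a ha g, _, hX x hx g, ?_⟩
    simp only [commutatorElement_def]
    group
  have hR : R.Normal := by
    change (Subgroup.closure S).Normal
    rw [← hSconj]
    exact Subgroup.normalClosure_normal
  have hRcard : Nat.card R ≤ n ^ (m * n) := by
    let _ : CommGroup A := { (inferInstance : Group A) with mul_comm := mul_comm' }
    have hfin : ((↑) ⁻¹' S : Set A).Finite := Set.toFinite _
    have h1 := Subgroup.card_closure_le_pow hn hfin.toFinset fun x hx =>
      Subtype.ext (hSn x (hfin.mem_toFinset.1 hx))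
    rw [hfin.coe_toFinset, ← Set.ncard_eq_toFinset_card _ hfin] at h1
    have h2 : R = (Subgroup.closure ((↑) ⁻¹' S : Set A)).map A.subtype := by
      rw [MonoidHom.map_closure, Subgroup.coe_subtype, Set.image_preimage_eq_of_subset]
      rw [Subtype.range_coe]
      exact hSA
    rw [h2, Subgroup.card_map_of_injective A.subtype_injective]
    refine h1.trans (Nat.pow_le_pow_right hn (le_trans ?_ hScard))
    rw [← Set.ncard_image_of_injective _ Subtype.val_injective]
    exact Set.ncard_le_ncard (Set.image_preimage_subset _ _)
  refine (card_commutator_le_mul_quotient R).trans (Nat.mul_le_mul hRcard ?_)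
  refine card_commutator_le_of_card_commutatorSet_le ?_
  have hπ := QuotientGroup.mk'_surjective R
  refine (card_commutatorSet_le_sq_index (A.map (QuotientGroup.mk' R)) ?_).trans
    (Nat.pow_le_pow_left ?_ 2)
  · rintro _ ⟨a, ha, rfl⟩
    have hle : Subgroup.closure (QuotientGroup.mk' R '' X) ≤
        Subgroup.centralizer {QuotientGroup.mk' R a} := by
      refine (Subgroup.closure_le _).2 ?_
      rintro _ ⟨x, hx, rfl⟩
      rw [SetLike.mem_coe, Subgroup.mem_centralizer_singleton_iff]
      have h1 : ⁅QuotientGroup.mk' R a, QuotientGroup.mk' R x⁆ = 1 := by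
        rw [← map_commutatorElement]
        exact (QuotientGroup.eq_one_iff _).2 (Subgroup.subset_closure ⟨a, ha, x, hx, rfl⟩)
      exact (commutatorElement_eq_one_iff_commute.1 h1).eq.symm
    rw [← MonoidHom.map_closure, hgen, Subgroup.map_top_of_surjective _ hπ] at hle
    rw [Subgroup.mem_center_iff]
    exact fun g => Subgroup.mem_centralizer_singleton_iff.1 (hle (Subgroup.mem_top g))
  · exact (Nat.le_of_dvd (Nat.pos_of_ne_zero Subgroup.index_ne_zero_of_finite)
      (Subgroup.index_map_dvd A hπ)).trans ht

theorem commutatorElement_mul_left_of_mem_center {G : Type*} [Group G]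
    (hG : ∀ x y : G, ⁅x, y⁆ ∈ Subgroup.center G) (x y z : G) :
    ⁅x * y, z⁆ = ⁅x, z⁆ * ⁅y, z⁆ := by
  have h := Subgroup.mem_center_iff.1 (hG y z)
  calc ⁅x * y, z⁆ = x * ⁅y, z⁆ * z * x⁻¹ * z⁻¹ := by simp only [commutatorElement_def]; group
    _ = ⁅y, z⁆ * ⁅x, z⁆ := by rw [h x]; simp only [commutatorElement_def]; group
    _ = _ := (h _).symm

theorem commutatorElement_mul_right_of_mem_center {G : Type*} [Group G]
    (hG : ∀ x y : G, ⁅x, y⁆ ∈ Subgroup.center G) (x y z : G) :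
    ⁅x, y * z⁆ = ⁅x, y⁆ * ⁅x, z⁆ := by
  have h := Subgroup.mem_center_iff.1 (hG x z)
  calc ⁅x, y * z⁆ = x * y * x⁻¹ * ⁅x, z⁆ * y⁻¹ := by simp only [commutatorElement_def]; group
    _ = ⁅x, z⁆ * ⁅x, y⁆ := by rw [h]; simp only [commutatorElement_def]; group
    _ = _ := (h _).symm

theorem card_commutatorSet_le_of_cyclic_quotient {G : Type*} [Group G] [Finite G]
    (hG : ∀ x y : G, ⁅x, y⁆ ∈ Subgroup.center G) (E : Subgroup G) (a : G)
    (ha : ∀ x : G, ∃ i : ℤ, ∃ u ∈ E, x = a ^ i * u) (F : Set G)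
    (hF : ∀ u ∈ E, ∃ f ∈ F, ∃ z ∈ Subgroup.center G, u = f * z) :
    Nat.card (commutatorSet G) ≤ F.ncard ^ 3 := by
  have hleft := commutatorElement_mul_left_of_mem_center hG
  have hright := commutatorElement_mul_right_of_mem_center hG
  have hcenter : ∀ z ∈ Subgroup.center G, ∀ x : G, ⁅x, z⁆ = 1 ∧ ⁅z, x⁆ = 1 := fun z hz x =>
    ⟨commutatorElement_eq_one_iff_commute.2 (Subgroup.mem_center_iff.1 hz x),
      commutatorElement_eq_one_iff_commute.2 (Subgroup.mem_center_iff.1 hz x).symm⟩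
  have hzl (x z : G) (i : ℤ) : ⁅x ^ i, z⁆ = ⁅x, z⁆ ^ i :=
    map_zpow (MonoidHom.mk' (fun x => ⁅x, z⁆) fun x y => hleft x y z) x i
  have hzr (z x : G) (i : ℤ) : ⁅z, x ^ i⁆ = ⁅z, x⁆ ^ i :=
    map_zpow (MonoidHom.mk' (fun x => ⁅z, x⁆) fun x y => hright z x y) x i
  -- In class 2, `⁅a^i u, a^k v⁆ = ⁅a, v^i u^{-k}⁆ ⁅u, v⁆`, and the entries `v^i u^{-k}`, `u`, `v`
  -- matter only modulo the center.
  have hsub : commutatorSet G ⊆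
      (fun f : G × G × G => ⁅a, f.1⁆ * ⁅f.2.1, f.2.2⁆) '' (F ×ˢ F ×ˢ F) := by
    rintro _ ⟨x, y, rfl⟩
    obtain ⟨i, u, hu, rfl⟩ := ha x
    obtain ⟨k, v, hv, rfl⟩ := ha y
    obtain ⟨f, hf, z, hz, hfz⟩ := hF (v ^ i * u ^ (-k)) (mul_mem (zpow_mem hv i) (zpow_mem hu _))
    obtain ⟨f₁, hf₁, z₁, hz₁, rfl⟩ := hF u hu
    obtain ⟨f₂, hf₂, z₂, hz₂, rfl⟩ := hF v hv
    refine ⟨(f, f₁, f₂), ⟨hf, hf₁, hf₂⟩, ?_⟩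
    have h1 : ⁅a, f⁆ = ⁅a, f₂⁆ ^ i * ⁅a, f₁⁆ ^ (-k) := by
      have h2 := hright a f z
      rw [← hfz, (hcenter z hz a).1, mul_one, hright, hzr, hzr, hright, hright,
        (hcenter z₁ hz₁ a).1, (hcenter z₂ hz₂ a).1, mul_one, mul_one] at h2
      exact h2.symm
    have h3 : ⁅f₁, a⁆ = ⁅a, f₁⁆⁻¹ := (commutatorElement_inv a f₁).symm
    change ⁅a, f⁆ * ⁅f₁, f₂⁆ = _
    rw [h1]
    simp only [hleft, hright, hzl, hzr, (hcenter z₁ hz₁ _).2,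
      (hcenter z₂ hz₂ _).1, mul_one, one_mul, commutatorElement_self,
      one_zpow, h3, zpow_neg, inv_zpow]
    rw [mul_assoc]
  rw [Nat.card_coe_set_eq]
  refine (Set.ncard_le_ncard hsub).trans ((Set.ncard_image_le (Set.toFinite _)).trans ?_)
  rw [Set.ncard_prod, Set.ncard_prod]
  exact le_of_eq (by ring)

theorem card_ker_pow_le {A : Type*} [CommGroup A] [Finite A] {m n : ℕ} (hn : 0 < n)
    (C : Fin m → Subgroup A) (hC : ∀ l, IsCyclic (C l)) (hgen : ⨆ l, C l = ⊤) :
    Nat.card (powMonoidHom n : A →* A).ker ≤ n ^ m := by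
  classical
  -- The kernel and cokernel of an endomorphism of a finite group have equal size, and the cokernel
  -- is generated by `m` elements of exponent `n`.
  have h1 : Nat.card (powMonoidHom n : A →* A).ker = (powMonoidHom n : A →* A).range.index := by
    have h2 := Subgroup.card_mul_index (powMonoidHom n : A →* A).ker
    rw [Subgroup.index_ker, ← Subgroup.card_mul_index (powMonoidHom n : A →* A).range,
      mul_comm] at h2
    exact Nat.eq_of_mul_eq_mul_left Nat.card_pos h2
  rw [h1, Subgroup.index]
  choose c hc using fun l => (hC l).exists_generator
  let π := QuotientGroup.mk' (powMonoidHom n : A →* A).range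
  have hπ : Function.Surjective π := QuotientGroup.mk'_surjective _
  let S : Finset (A ⧸ (powMonoidHom n : A →* A).range) :=
    Finset.univ.image fun l => π (c l)
  have hS : Subgroup.closure (S : Set (A ⧸ (powMonoidHom n : A →* A).range)) = ⊤ := by
    rw [eq_top_iff, ← Subgroup.map_top_of_surjective π hπ, ← hgen, Subgroup.map_iSup]
    refine iSup_le fun l => ?_
    rintro _ ⟨x, hx, rfl⟩
    obtain ⟨i, hi⟩ := hc l ⟨x, hx⟩
    have hi' : (c l : A) ^ i = x := congrArg Subtype.val hi
    rw [← hi', map_zpow]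
    exact zpow_mem (Subgroup.subset_closure (by simp [S])) i
  have h3 := Subgroup.card_closure_le_pow hn S fun x _ => by
    obtain ⟨x, rfl⟩ := hπ x
    rw [← map_pow]
    exact (QuotientGroup.eq_one_iff _).2 ⟨x, rfl⟩
  rw [hS, Subgroup.card_top] at h3
  exact h3.trans (Nat.pow_le_pow_right hn (Finset.card_image_le.trans (by simp)))

/-- A bound for the index of `⁅K, K⁆` in the subgroup of elements whose `m!`-th power is a
product of commutators, where `K` is the `powerNormalizer` of a normal generating set covered by
`m` cyclic subgroups. -/
def powCommutatorIndexBound (m : ℕ) : ℕ :=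
  (m !) ^ m * ((m !) ^ (m * m !) *
    Subgroup.cardCommutatorBound (finiteNormalBound (m * m ! + 1) (m !) ^ 2))

/-- The bound for the order of `Δ`. -/
def coveringBound (m : ℕ) : ℕ :=
  powCommutatorIndexBound m * Subgroup.cardCommutatorBound (powCommutatorIndexBound m ^ 3)

/-- The homomorphism `x ↦ x ^ n` to the abelianization. -/
def abelianizationPow (G : Type*) [Group G] (n : ℕ) : G →* Abelianization G :=
  (powMonoidHom n).comp Abelianization.of

/-! ### Bounding the kernel of `x ↦ x^{m!}` into the abelianization. -/

section Covering

variable {G : Type*} [Group G] [Finite G] {X : Set G} {m : ℕ}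

theorem card_commutator_le_mul_card_commutator_powerNormalizer
    (C : Fin m → Subgroup G) (hC : ∀ l, IsCyclic (C l))
    (hX : ∀ x ∈ X, ∀ g : G, g * x * g⁻¹ ∈ X) (hgen : Subgroup.closure X = ⊤)
    (hXC : X ⊆ ⋃ l, (C l : Set G)) :
    Nat.card (commutator G) ≤ Nat.card (⁅powerNormalizer X, powerNormalizer X⁆ : Subgroup G) *
      ((m !) ^ (m * m !) *
        Subgroup.cardCommutatorBound (finiteNormalBound (m * m ! + 1) (m !) ^ 2)) := by
  have hK := powerNormalizer_normal hX
  refine (card_commutator_le_mul_quotient ⁅powerNormalizer X, powerNormalizer X⁆).trans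
    (Nat.mul_le_mul_left _ ?_)
  let π := QuotientGroup.mk' ⁅powerNormalizer X, powerNormalizer X⁆
  have hπ : Function.Surjective π := QuotientGroup.mk'_surjective _
  have hAn : ((powerNormalizer X).map π).Normal := hK.map π hπ
  have hAc : IsMulCommutative ((powerNormalizer X).map π) := by
    refine IsMulCommutative.of_comm ?_
    rintro ⟨_, a, ha, rfl⟩ ⟨_, b, hb, rfl⟩
    refine Subtype.ext ?_
    change π a * π b = π b * π a
    refine (commutatorElement_eq_one_iff_commute.1 ?_).eq
    rw [← map_commutatorElement]
    exact (QuotientGroup.eq_one_iff _).2 (Subgroup.commutator_mem_commutator ha hb)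
  refine card_commutator_le_of_abelian_normal (X := π '' X) (fun l => (C l).map π) ?_ ?_ ?_ ?_
    ((powerNormalizer X).map π) ?_ (Nat.factorial_pos m) ?_ ?_
  · intro l
    have := hC l
    exact isCyclic_of_surjective (π.subgroupMap (C l)) (π.subgroupMap_surjective (C l))
  · rintro _ ⟨x, hx, rfl⟩ g
    obtain ⟨g, rfl⟩ := hπ g
    exact ⟨_, hX x hx g, by simp⟩
  · rw [← MonoidHom.map_closure, hgen, Subgroup.map_top_of_surjective _ hπ]
  · rintro _ ⟨x, hx, rfl⟩
    obtain ⟨l, hl⟩ := Set.mem_iUnion.1 (hXC hx)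
    exact Set.mem_iUnion.2 ⟨l, x, hl, rfl⟩
  · rintro _ ⟨a, ha, rfl⟩ _ ⟨x, hx, rfl⟩
    rw [← map_mul, ← map_inv, ← map_mul, ← MonoidHom.map_zpowers]
    exact ⟨_, ha x hx, rfl⟩
  · intro g
    obtain ⟨g, rfl⟩ := hπ g
    exact ⟨_, pow_factorial_mem_powerNormalizer C hC hX hXC g, map_pow _ _ _⟩
  · exact (Nat.le_of_dvd (Nat.pos_of_ne_zero Subgroup.index_ne_zero_of_finite)
      (Subgroup.index_map_dvd _ hπ)).trans (index_powerNormalizer_le C hC hX hgen hXC)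

theorem card_ker_abelianizationPow_le_mul
    (C : Fin m → Subgroup G) (hC : ∀ l, IsCyclic (C l))
    (hX : ∀ x ∈ X, ∀ g : G, g * x * g⁻¹ ∈ X) (hgen : Subgroup.closure X = ⊤)
    (hXC : X ⊆ ⋃ l, (C l : Set G)) :
    Nat.card (abelianizationPow G (m !)).ker ≤ powCommutatorIndexBound m *
      Nat.card (⁅powerNormalizer X, powerNormalizer X⁆ : Subgroup G) := by
  have hof : Function.Surjective (Abelianization.of : G →* _) := QuotientGroup.mk'_surjective _
  rw [← Subgroup.card_map_mul_card_inf_ker Abelianization.of (abelianizationPow G (m !)).ker,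
    powCommutatorIndexBound, mul_assoc]
  have hle : (abelianizationPow G (m !)).ker.map Abelianization.of ≤
      (powMonoidHom (m !) : Abelianization G →* Abelianization G).ker := by
    rintro _ ⟨x, hx, rfl⟩
    exact hx
  refine Nat.mul_le_mul ?_ ?_
  · refine (Subgroup.card_le_of_le hle).trans
      (card_ker_pow_le (Nat.factorial_pos m) (fun l => (C l).map Abelianization.of) ?_ ?_)
    · intro l
      have := hC l
      exact isCyclic_of_surjective (Abelianization.of.subgroupMap (C l))
        (Abelianization.of.subgroupMap_surjective (C l))
    · rw [← Subgroup.map_iSup, eq_top_iff, ← Subgroup.map_top_of_surjective _ hof, ← hgen]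
      refine Subgroup.map_mono ((Subgroup.closure_le _).2 fun x hx => ?_)
      obtain ⟨l, hl⟩ := Set.mem_iUnion.1 (hXC hx)
      exact Subgroup.mem_iSup_of_mem l hl
  · refine (Subgroup.card_le_of_le inf_le_right).trans ?_
    rw [Abelianization.ker_of, mul_comm]
    exact card_commutator_le_mul_card_commutator_powerNormalizer C hC hX hgen hXC

theorem card_ker_abelianizationPow_le
    (C : Fin m → Subgroup G) (hC : ∀ l, IsCyclic (C l))
    (hX : ∀ x ∈ X, ∀ g : G, g * x * g⁻¹ ∈ X) (hgen : Subgroup.closure X = ⊤)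
    (hXC : X ⊆ ⋃ l, (C l : Set G))
    (hcyc : IsCyclic (powMonoidHom (m !) : Abelianization G →* Abelianization G).range) :
    Nat.card (abelianizationPow G (m !)).ker ≤ coveringBound m := by
  refine (card_ker_abelianizationPow_le_mul C hC hX hgen hXC).trans (Nat.mul_le_mul_left _ ?_)
  set K := powerNormalizer X
  have hK : K.Normal := powerNormalizer_normal hX
  have hcenter := commutator_powerNormalizer_le_center hgen
  have hmap : (commutator K).map K.subtype = ⁅K, K⁆ := by
    rw [commutator_def, Subgroup.map_commutator, ← MonoidHom.range_eq_map, Subgroup.range_subtype]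
  have hcc : commutator K ≤ Subgroup.center K := by
    intro x hx
    rw [Subgroup.mem_center_iff]
    intro g
    have h1 : (x : G) ∈ ⁅K, K⁆ := hmap ▸ ⟨x, hx, rfl⟩
    exact Subtype.ext (Subgroup.mem_center_iff.1 (hcenter h1) g)
  have hG : ∀ x y : K, ⁅x, y⁆ ∈ Subgroup.center K := fun x y =>
    hcc (Subgroup.commutator_mem_commutator (Subgroup.mem_top x) (Subgroup.mem_top y))
  have hcard : Nat.card (commutator K) = Nat.card (⁅K, K⁆ : Subgroup G) := by
    rw [← hmap, Subgroup.card_map_of_injective K.subtype_injective]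
  let ψ : K →* Abelianization G := (abelianizationPow G (m !)).comp K.subtype
  have hψ : IsCyclic ψ.range := by
    refine isCyclic_of_injective (Subgroup.inclusion (K := (powMonoidHom (m !)).range) ?_)
      (Subgroup.inclusion_injective _)
    rintro _ ⟨x, rfl⟩
    exact ⟨_, rfl⟩
  obtain ⟨⟨_, a, rfl⟩, ha⟩ := hψ.exists_generator
  have hZE : commutator K ≤ ψ.ker := Abelianization.commutator_subset_ker ψ
  -- `F` is a transversal of `[K,K]` in `ker ψ`. Its size is bounded without knowing `|[K,K]|`: the
  -- estimate of `card_ker_abelianizationPow_le_mul` carries the factor `|[K,K]|`, which cancels.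
  let F : Set K := {f | f ∈ ψ.ker ∧ f = (f : K ⧸ commutator K).out}
  have hFcard : F.ncard ≤ powCommutatorIndexBound m := by
    have h1 : F.ncard ≤ Nat.card (ψ.ker.map (QuotientGroup.mk' (commutator K))) := by
      rw [← Nat.card_coe_set_eq]
      refine Nat.card_le_card_of_injective (fun f : F => ⟨_, f.1, f.2.1, rfl⟩) fun f g hfg => ?_
      have h2 : ((f : K) : K ⧸ commutator K) = ((g : K) : K ⧸ commutator K) :=
        congrArg Subtype.val hfg
      exact Subtype.ext (by rw [f.2.2, h2, ← g.2.2])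
    refine h1.trans (Nat.le_of_mul_le_mul_right ?_ (Nat.card_pos (α := commutator K)))
    have h2 := Subgroup.card_map_mul_card_inf_ker (QuotientGroup.mk' (commutator K)) ψ.ker
    rw [QuotientGroup.ker_mk', inf_eq_right.2 hZE] at h2
    rw [h2, hcard]
    refine le_trans ?_ (card_ker_abelianizationPow_le_mul C hC hX hgen hXC)
    rw [← Subgroup.card_map_of_injective K.subtype_injective]
    refine Subgroup.card_le_of_le ?_
    rintro _ ⟨x, hx, rfl⟩
    exact hx
  rw [← hcard]
  refine card_commutator_le_of_card_commutatorSet_le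
    ((card_commutatorSet_le_of_cyclic_quotient hG ψ.ker a ?_ F ?_).trans
      (Nat.pow_le_pow_left hFcard 3))
  · intro x
    obtain ⟨i, hi⟩ := ha ⟨ψ x, x, rfl⟩
    have hi' : ψ a ^ i = ψ x := congrArg Subtype.val hi
    refine ⟨i, (a ^ i)⁻¹ * x, ?_, by group⟩
    rw [MonoidHom.mem_ker, map_mul, map_inv, map_zpow, hi', inv_mul_cancel]
  · intro u hu
    obtain ⟨z, hz⟩ := QuotientGroup.mk_out_eq_mul (commutator K) u
    refine ⟨(u : K ⧸ commutator K).out, ⟨?_, ?_⟩, (z : K)⁻¹, inv_mem (hcc z.2), ?_⟩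
    · rw [hz]
      exact mul_mem hu (hZE z.2)
    · rw [QuotientGroup.out_eq']
    · rw [hz, mul_inv_cancel_right]

end Covering

/-! ### Assembly of part (i). -/

section GammaStar

open scoped IsMulCommutative

variable {G : Type*} [Group G] [Finite G]

/-- Passing to `G/[N,N]` reduces to the abelian case: `γ_j^*` of this quotient is `N/[N,N]`, and
both the commutators and their covering descend. -/
theorem isCyclic_range_pow_abelianization_gammaStar {m i : ℕ} (C : Fin m → Subgroup G)
    (hC : ∀ l, IsCyclic (C l)) (hcov : gammaStarCommutators G (i + 1) ⊆ ⋃ l, (C l : Set G)) :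
    IsCyclic (powMonoidHom (m !) : Abelianization (gammaStar G (i + 1)) →* _).range := by
  set N := gammaStar G (i + 1)
  let π := QuotientGroup.mk' ⁅N, N⁆
  have hπ : Function.Surjective π := QuotientGroup.mk'_surjective _
  have hmap : N.map π = gammaStar (G ⧸ ⁅N, N⁆) (i + 1) := gammaStar_map π hπ (i + 1)
  have hc : IsMulCommutative (gammaStar (G ⧸ ⁅N, N⁆) (i + 1)) := by
    refine IsMulCommutative.of_comm ?_
    rintro ⟨x, hx⟩ ⟨y, hy⟩
    rw [← hmap] at hx hy
    obtain ⟨a, ha, rfl⟩ := hx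
    obtain ⟨b, hb, rfl⟩ := hy
    refine Subtype.ext ?_
    change π a * π b = π b * π a
    refine (commutatorElement_eq_one_iff_commute.1 ?_).eq
    rw [← map_commutatorElement]
    exact (QuotientGroup.eq_one_iff _).2 (Subgroup.commutator_mem_commutator ha hb)
  have hcyc := isCyclic_range_pow_of_isMulCommutative (G := G ⧸ ⁅N, N⁆) (i := i)
    (fun l => (C l).map π) (fun l => by
      have := hC l
      exact isCyclic_of_surjective (π.subgroupMap (C l)) (π.subgroupMap_surjective (C l)))
    (fun x hx => by
      obtain ⟨g, hg, rfl⟩ := exists_gammaStarCommutators_map_eq π hπ _ hx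
      obtain ⟨l, hl⟩ := Set.mem_iUnion.1 (hcov hg)
      exact Set.mem_iUnion.2 ⟨l, g, hl, rfl⟩)
  let θ : N →* gammaStar (G ⧸ ⁅N, N⁆) (i + 1) :=
    (π.comp N.subtype).codRestrict _ fun x => hmap ▸ ⟨x, x.2, rfl⟩
  let μ : Abelianization N →* gammaStar (G ⧸ ⁅N, N⁆) (i + 1) := Abelianization.lift θ
  have hμ : Function.Injective μ := by
    rw [injective_iff_map_eq_one]
    intro x hx
    obtain ⟨x, rfl⟩ : ∃ y, Abelianization.of y = x := QuotientGroup.mk'_surjective _ x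
    have h1 : π x = 1 := congrArg Subtype.val hx
    have h2 : (x : G) ∈ ⁅N, N⁆ := (QuotientGroup.eq_one_iff _).1 h1
    rw [← MonoidHom.mem_ker, Abelianization.ker_of]
    have h3 : (commutator N).map N.subtype = ⁅N, N⁆ := by
      rw [commutator_def, Subgroup.map_commutator, ← MonoidHom.range_eq_map,
        Subgroup.range_subtype]
    rw [← h3] at h2
    obtain ⟨y, hy, hyx⟩ := h2
    rwa [← Subtype.ext hyx]
  have hmaps : ∀ x ∈ (powMonoidHom (m !) : Abelianization N →* _).range,
      μ x ∈ (powMonoidHom (m !) : gammaStar (G ⧸ ⁅N, N⁆) (i + 1) →* _).range := by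
    rintro _ ⟨x, rfl⟩
    exact ⟨μ x, (map_pow μ x _).symm⟩
  exact isCyclic_of_injective
    ((μ.comp (powMonoidHom (m !) : Abelianization N →* _).range.subtype).codRestrict _
      fun x => hmaps x x.2)
    fun x y hxy => Subtype.ext (hμ (congrArg Subtype.val hxy))

theorem exists_normal_card_le_isCyclic_quotient {m i : ℕ} (C : Fin m → Subgroup G)
    (hC : ∀ l, IsCyclic (C l)) (hcov : gammaStarCommutators G (i + 1) ⊆ ⋃ l, (C l : Set G)) :
    ∃ (Δ : Subgroup G) (_ : Δ.Normal), Δ ≤ gammaStar G (i + 1) ∧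
      Nat.card Δ ≤ coveringBound m ∧
      IsCyclic (gammaStar G (i + 1) ⧸ Δ.subgroupOf (gammaStar G (i + 1))) := by
  have hcyc := isCyclic_range_pow_abelianization_gammaStar C hC hcov
  set N := gammaStar G (i + 1)
  let D := (abelianizationPow N (m !)).ker
  have hcard : Nat.card D ≤ coveringBound m := by
    refine card_ker_abelianizationPow_le
      (X := ((↑) ⁻¹' gammaStarCommutators G (i + 1) : Set N))
      (fun l => (C l).subgroupOf N) (fun l => ?_) (fun x hx g => ?_) ?_ (fun x hx => ?_) hcyc
    · have := hC l
      exact isCyclic_of_injective (N.subtype.subgroupComap (C l))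
        fun x y hxy => Subtype.ext (Subtype.ext (congrArg (fun z : C l => (z : G)) hxy))
    · exact gammaStarCommutators_conj _ hx g
    · exact Subgroup.closure_closure_coe_preimage
    · obtain ⟨l, hl⟩ := Set.mem_iUnion.1 (hcov hx)
      exact Set.mem_iUnion.2 ⟨l, hl⟩
  have hchar : D.Characteristic := by
    refine Subgroup.characteristic_iff_le_comap.2 fun e x hx => ?_
    have h1 : Abelianization.of (x ^ m !) = 1 := by
      rw [map_pow]; exact hx
    have h2 := congrArg (Abelianization.map e.toMonoidHom) h1
    rw [Abelianization.map_of, map_one] at h2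
    change Abelianization.of (e x) ^ m ! = 1
    rw [← map_pow, ← map_pow]
    exact h2
  refine ⟨D.map N.subtype, inferInstance, Subgroup.map_subtype_le D, ?_, ?_⟩
  · rwa [Subgroup.card_map_of_injective N.subtype_injective]
  · have h1 : (D.map N.subtype).subgroupOf N = D :=
      Subgroup.comap_map_eq_self_of_injective N.subtype_injective D
    have hrange : (abelianizationPow N (m !)).range ≤
        (powMonoidHom (m !) : Abelianization N →* Abelianization N).range := by
      rintro _ ⟨x, rfl⟩
      exact ⟨_, rfl⟩
    have h2 : IsCyclic (N ⧸ D) :=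
      isCyclic_of_injective ((Subgroup.inclusion hrange).comp
        (QuotientGroup.quotientKerEquivRange (abelianizationPow N (m !))).toMonoidHom)
        ((Subgroup.inclusion_injective hrange).comp (MulEquiv.injective _))
    exact isCyclic_of_injective (QuotientGroup.quotientMulEquivOfEq h1).toMonoidHom
      (MulEquiv.injective _)

end GammaStar

theorem theorem1p1 :
    (∃ f : ℕ → ℕ, ∀ (m j : ℕ), 1 ≤ j → ∀ (G : Type u) [Group G] [Finite G]
      (C : Fin m → Subgroup G), (∀ i, IsCyclic (C i)) →
      gammaStarCommutators G j ⊆ ⋃ i, (C i : Set G) →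
      ∃ (Δ : Subgroup G) (_ : Δ.Normal), Δ ≤ gammaStar G j ∧ Nat.card Δ ≤ f m ∧
        IsCyclic (gammaStar G j ⧸ Δ.subgroupOf (gammaStar G j))) ∧
    (∀ (j : ℕ), 2 ≤ j → ∀ (G : Type u) [Group G] [Finite G],
      gammaStar G j = gammaInfty G) := by
  refine ⟨⟨coveringBound, ?_⟩, ?_⟩
  · intro m j hj G _ _ C hC hcov
    obtain ⟨i, rfl⟩ := Nat.exists_eq_add_of_le' hj
    exact exists_normal_card_le_isCyclic_quotient C hC hcov
  · intro j hj G _ _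
    obtain ⟨i, rfl⟩ := Nat.exists_eq_add_of_le' hj
    exact gammaStar_eq_gammaInfty i G
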